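/- **Setting.** Fix $m\ge 1$. For each $n$ let $X_1,\dots,X_n$ (that is, $X_{n,1},\dots,X_{n,n}$) be independent random variables with values in a measurable space $\mathcal X$, $X_i\sim P_i=P_{n,i}$ (not necessarily identically distributed), let $a=a_n$ be a real weight function on $m$-tuples of indices and $h=h_n:\mathcal X^m\to\mathbb R$ a measurable kernel (no symmetry is assumed). Let $I_n^m$ be the set of $m$-tuples of pairwise distinct indices in $[n]=\{1,\dots,n\}$, and $$U_n=\frac{(n-m)!}{n!}\sum_{(i_1,\dots,i_m)\in I_n^m}a(i_1,\dots,i_m)\,h(X_{i_1},\dots,X_{i_m}),\qquad \sigma_n^2=\mathrm{Var}(U_n).$$ For $l\in[m]$ let $\pi_l(y;y_1,\dots,y_{m-1})=(y_1,\dots,y_{l-1},y,y_l,\dots,y_{m-1})$. Put $\theta(i_1,\dots,i_m)=\int h\,dP_{i_1}\cdots dP_{i_m}$, $f^{(l)}_{i_1,\dots,i_{m-1}}(x)=\int h\{\pi_l(x;y_1,\dots,y_{m-1})\}\,dP_{i_1}(y_1)\cdots dP_{i_{m-1}}(y_{m-1})$ and $$h_{1,i}(x)=\frac{(n-m)!}{(n-1)!}\sum_{i_1,\dots,i_{m-1}}\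 \sum_{l=1}^m a\{\pi_l(i;i_1,\dots,i_{m-1})\}\Big[f^{(l)}_{i_1,\dots,i_{m-1}}(x)-\theta\{\pi_l(i;i_1,\dots,i_{m-1})\}\Big],$$ the outer sum being over the tuples of pairwise distinct indices in $[n]\setminus\{i\}$. Let $V(n)=\mathrm{Var}\{n^{-1}\sum_{i=1}^n h_{1,i}(X_i)\}$. For $K\ge2$ and $q\ge 0$ let $A_{K,q}(n)$ be the average of $|a(\boldsymbol i^{(1)})\cdots a(\boldsymbol i^{(K)})|$ over all $(\boldsymbol i^{(1)},\dots,\boldsymbol i^{(K)})\in (I_n^m)^K$ whose $K$ index sets have at least $q$ indices in common (an average over the empty set is $0$). Let $$M_1(n)=\max_{\boldsymbol i,\boldsymbol j\in I_n^m}|\theta(\boldsymbol i)-\theta(\boldsymbol j)|,$$ $$M_2(n)=\max\Big|E\big[E\{h(X_{r_1},\dots,X_{r_m})h(X_{s_1},\dots,X_{s_m})\mid X_{k_p}\}\big]-E\big[E\{h(X_{k_1},\dots,X_{k_m})h(X_{s_1},\dots,X_{s_m})\mid X_{k_p}\}\big]\Big|,$$ the last maximum being over $p,q\in[m]$ and $\boldsymbol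 r,\boldsymbol s,\boldsymbol k\in I_n^m$ such that $\boldsymbol r$ and $\boldsymbol s$ have exactly the index $r_p=s_q$ in common, and $\boldsymbol k$ and $\boldsymbol s$ have exactly the index $k_p=s_q$ in common (a maximum over the empty set is $0$). **Theorem (consistency of the bootstrap variance).** Assume the conditions of the central limit theorem for $U_n$: for every $n$ there is $M(n)>0$ with $\max_{(i_1,\dots,i_m)\in I_n^m}E\{h(X_{i_1},\dots,X_{i_m})^4\}\le M(n)$, $V(n)>0$ for all large $n$, and $$n^{-2}V(n)^{-1}A_{2,2}(n)M(n)^{1/2}\to0,\qquad n^{-2}V(n)^{-3/2}A_{3,1}(n)M(n)^{3/4}\to0 .$$ Assume moreover: (i) (Bounded second moments of the von Mises type kernel, repeated indices standing for the same variable or for independent copies.) $$\limsup_{n\to\infty}\max_{1\le i_1,\dots,i_m\le n}E\{h(X_{i_1},\dots,X_{i_m})^2\}<\infty,$$ $$\limsup_{n\to\infty}\max_{l,\,j,\,(i_1,\dots,i_{m-1})}\int\!\!\int h\{\pi_l(x;y_1,\dots,y_{m-1})\}^2\,dP_{i_1}(y_1)\cdots dP_{i_{m-1}}(y_{m-1})\,dP_j(x)<\infty,$$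 where in the second line $l\in[m]$, $j\in[n]$, and $(i_1,\dots,i_{m-1})$ runs over the tuples of pairwise distinct indices in $[n]$ ($j$ may be one of them). (ii) (Control of heterogeneity.) $$\frac1n\sum_{i=1}^n\sum_{j=1}^n\Big\{\frac{h_{1,i}(X_j)}{n\sigma_n}\Big\}^2\xrightarrow{P}1,\qquad \frac1{n^2}\sum_{i=1}^n\Big\{\sum_{j=1}^n\frac{h_{1,i}(X_j)}{n\sigma_n}\Big\}^2\xrightarrow{P}0,$$ $$n^{-1}\sigma_n^{-2}A_{2,1}(n)\{M_1(n)^2+M_2(n)+n^{-1}\}\to0 .$$ Given $X_1,\dots,X_n$, let $X_1^*,\dots,X_n^*$ be i.i.d. draws from the empirical distribution of $X_1,\dots,X_n$, let $$U_n^*=\frac{(n-m)!}{n!}\sum_{(i_1,\dots,i_m)\in I_n^m}a(i_1,\dots,i_m)\,h(X^*_{i_1},\dots,X^*_{i_m}),$$ and let $\mathrm{Var}^*$ denote the conditional variance given $X_1,\dots,X_n$. Then $$\big|\mathrm{Var}^*(\sigma_n^{-1}U_n^*)-\mathrm{Var}(\sigma_n^{-1}U_n)\big|\xrightarrow{P}0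 .$$ -/

import Mathlib

open MeasureTheory ProbabilityTheory Filter
open scoped Topology ENNReal Nat

noncomputable section

namespace WeightedU

/-- `I_n^m`: the `m`-tuples of pairwise distinct indices in an `n`-element index set. -/
def distinctTuples (n m : ℕ) : Finset (Fin m → Fin n) :=
  Finset.univ.filter fun i => Function.Injective i

/-- `I_{n-1}^{m}(-i)`: the `m`-tuples of pairwise distinct indices, all different from `i`. -/
def distinctTuplesAvoiding {n : ℕ} (m : ℕ) (i : Fin n) : Finset (Fin m → Fin n) :=
  Finset.univ.filter fun j => Function.Injective j ∧ ∀ k, j k ≠ i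

/-- The `K`-tuples of elements of `I_n^m` that share at least `q` common indices. -/
def sharing (n m K q : ℕ) : Finset (Fin K → Fin m → Fin n) :=
  Finset.univ.filter fun t =>
    (∀ k, Function.Injective (t k)) ∧
      q ≤ (Finset.univ.filter fun c : Fin n => ∀ k, ∃ l, t k l = c).card

/-- The average weight `A_{K,q}(n)`. -/
def avgWeight {n m : ℕ} (a : (Fin m → Fin n) → ℝ) (K q : ℕ) : ℝ :=
  ((sharing n m K q).card : ℝ)⁻¹ * ∑ t ∈ sharing n m K q, |∏ k, a (t k)|

/-- The weighted U-statistic of degree `m` with weights `a` and kernel `h`, as a function of the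
sample `x`. -/
def uStat {𝒳 : Type*} {n m : ℕ} (a : (Fin m → Fin n) → ℝ) (h : (Fin m → 𝒳) → ℝ)
    (x : Fin n → 𝒳) : ℝ :=
  ((n - m)! : ℝ) / (n ! : ℝ) * ∑ i ∈ distinctTuples n m, a i * h (fun l => x (i l))

section Projection

variable {𝒳 : Type*} [MeasurableSpace 𝒳] {n d : ℕ}

/-- `θ(i₁,…,i_m) = ∫ h(y₁,…,y_m) dP_{i₁}(y₁) ⋯ dP_{i_m}(y_m)`. -/
def theta (Q : Fin n → Measure 𝒳) {m : ℕ} (h : (Fin m → 𝒳) → ℝ) (i : Fin m → Fin n) : ℝ :=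
  ∫ y, h y ∂Measure.pi fun l => Q (i l)

/-- `f^{(l)}_{i₁,…,i_{m-1}}(x)`, with `m = d + 1`: the point `x` stands in position `l`, the other
arguments are integrated against `P_{i₁}, …, P_{i_{m-1}}`. -/
def condKernel (Q : Fin n → Measure 𝒳) (h : (Fin (d + 1) → 𝒳) → ℝ) (l : Fin (d + 1))
    (i : Fin d → Fin n) (x : 𝒳) : ℝ :=
  ∫ y : Fin d → 𝒳, h (l.insertNth x y) ∂Measure.pi fun k => Q (i k)

/-- The first order expansion `h_{1,i}`, with `m = d + 1`. -/
def h1 (Q : Fin n → Measure 𝒳) (a : (Fin (d + 1) → Fin n) → ℝ) (h : (Fin (d + 1) → 𝒳) → ℝ)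
    (i : Fin n) (x : 𝒳) : ℝ :=
  ((n - (d + 1))! : ℝ) / ((n - 1)! : ℝ) *
    ∑ j ∈ distinctTuplesAvoiding d i, ∑ l : Fin (d + 1),
      a (l.insertNth i j) * (condKernel Q h l j x - theta Q h (l.insertNth i j))

/-- The empirical distribution of the points `x₁, …, x_n`. -/
def empirical (x : Fin n → 𝒳) : Measure 𝒳 :=
  (n : ℝ≥0∞)⁻¹ • ∑ j, Measure.dirac (x j)

/-- The conditional law of the bootstrap sample `(X₁*, …, X_n*)` given `X = x`: `n` independent
draws from the empirical distribution of `x`. -/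
def bootstrapLaw (x : Fin n → 𝒳) : Measure (Fin n → 𝒳) :=
  Measure.pi fun _ => empirical x

end Projection

section Sample

variable {Ω 𝒳 : Type*} [MeasurableSpace Ω] [MeasurableSpace 𝒳] {n : ℕ}

/-- The distributions `P_i` of the `X_i`. -/
def laws (P : Measure Ω) (X : Fin n → Ω → 𝒳) (i : Fin n) : Measure 𝒳 :=
  P.map (X i)

/-- `σ_n`, the standard deviation of the U-statistic. -/
def sigma (P : Measure Ω) (X : Fin n → Ω → 𝒳) {m : ℕ} (a : (Fin m → Fin n) → ℝ)
    (h : (Fin m → 𝒳) → ℝ) : ℝ :=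
  √(Var[fun ω => uStat a h (fun i => X i ω); P])

/-- `V(n)`, the variance of `n⁻¹ ∑ᵢ h_{1,i}(X_i)`. -/
def mainVar (P : Measure Ω) (X : Fin n → Ω → 𝒳) {d : ℕ} (a : (Fin (d + 1) → Fin n) → ℝ)
    (h : (Fin (d + 1) → 𝒳) → ℝ) : ℝ :=
  Var[fun ω => (n : ℝ)⁻¹ * ∑ i, h1 (laws P X) a h i (X i ω); P]

/-- `M₁(n)`, the largest difference of the means `θ` over pairs of tuples (`0` if there are none). -/
def meanGap (P : Measure Ω) (X : Fin n → Ω → 𝒳) {m : ℕ} (h : (Fin m → 𝒳) → ℝ) : ℝ :=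
  sSup {v : ℝ | ∃ i ∈ distinctTuples n m, ∃ j ∈ distinctTuples n m,
    v = |theta (laws P X) h i - theta (laws P X) h j|}

/-- `E[E{h(X_r) h(X_s) ∣ X_c}]`. -/
def crossMoment (P : Measure Ω) (X : Fin n → Ω → 𝒳) {m : ℕ} (h : (Fin m → 𝒳) → ℝ)
    (r s : Fin m → Fin n) (c : Fin n) : ℝ :=
  ∫ ω, (P[fun ω' => h (fun l => X (r l) ω') * h (fun l => X (s l) ω') |
    MeasurableSpace.comap (X c) inferInstance]) ω ∂P

/-- `M₂(n)`: the largest difference of the second moments above, over positions `p`, `q` and tuples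
`r`, `s`, `k` such that `r` and `s` have only `r_p = s_q` in common, and `k` and `s` have only
`k_p = s_q` in common (`0` if there are none). -/
def crossGap (P : Measure Ω) (X : Fin n → Ω → 𝒳) {m : ℕ} (h : (Fin m → 𝒳) → ℝ) : ℝ :=
  sSup {v : ℝ | ∃ p q : Fin m, ∃ r ∈ distinctTuples n m, ∃ s ∈ distinctTuples n m,
    ∃ k ∈ distinctTuples n m,
      Set.range r ∩ Set.range s = {r p} ∧ r p = s q ∧
      Set.range k ∩ Set.range s = {k p} ∧ k p = s q ∧
      v = |crossMoment P X h r s (k p) - crossMoment P X h k s (k p)|}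

end Sample

/-- Convergence in probability to a constant, for random variables `Z n` that may live on different
probability spaces. -/
def TendstoInProb {Ω : ℕ → Type*} [∀ n, MeasurableSpace (Ω n)] (P : ∀ n, Measure (Ω n))
    (Z : ∀ n, Ω n → ℝ) (c : ℝ) : Prop :=
  ∀ ε : ℝ, 0 < ε → Tendsto (fun n => P n {ω | ε ≤ |Z n ω - c|}) atTop (𝓝 0)

end WeightedU

end

open WeightedU

noncomputable section

namespace WeightedU

/-! ### Second-moment inequalities -/

section SecondMoments

variable {α : Type*} [MeasurableSpace α] {μ : Measure α}

/-! After normalisation the true variance is 1, so the claim is that Var*(U*) / σ² tends to 1 in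
probability. Write P̂ for the empirical distribution and ĥ₁ for the first order expansion formed
under P̂ instead of the true laws. The proof runs along the chain Var*(U*) ≈ n⁻² ∑ Var_P̂(ĥ₁,ₜ) ≈
n⁻² ∑ Var_P̂(h₁,ₜ). The last quantity divided by σ² is exactly the difference of the two random sums
in the heterogeneity condition (`sum_sq_sub_sq_sum_eq`), hence tends to 1.

The first approximation is `abs_variance_uStat_sub_mainVar_le`, valid for any independent sample. In
the double sum over pairs of index tuples, pairs with no common index contribute zero. Pairs with
exactly one contribute equally to the U-statistic and to its projection, by conditioning on the
shared variable. Only pairs with at least two common indices are left. The bound is used twice: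
under the true law, to get σ² ≥ V/2 and so transfer the rate of the central limit theorem from V to
σ²; and under the bootstrap law (`abs_variance_bootstrap_sub_le`), where the second moment of the
kernel is the random average `meanSqKernel`, of mean at most √M + O(1/n).

The second approximation is controlled by the mean square distance `projGap` between the two
expansions (`abs_sum_variance_sub_le_projGap`). Its expectation is bounded in `integral_projGap_le`,
the heart of the proof. The error of each projection is an average of the deviations `kernelDev`
over free indices, so a product of two errors is an average over 2d + 1 free indices. Up to a
fraction O(1/n), these are distinct and avoid the two given tuples. For a pair of tuples with one
common index, the expectation is then a combination of cross moments that differ only by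
heterogeneity, hence at most 2M₂. For pairs with more common indices a second-moment bound of order
√M suffices, because such pairs are rarer by a factor n.

Counting pairs by common indices (`factorial_ratio_sq_mul_shareSum_le`) turns these bounds into the
assumed rates, and Markov's inequality turns expectations into convergence in probability. -/

lemma memLp_two_of_lintegral_sq_lt_top {f : α → ℝ} (hf : AEStronglyMeasurable f μ)
    (hfin : ∫⁻ x, ENNReal.ofReal (f x ^ 2) ∂μ < ⊤) : MemLp f 2 μ := by
  rw [memLp_two_iff_integrable_sq hf]
  refine ⟨hf.pow 2, ?_⟩
  rw [hasFiniteIntegral_iff_ofReal (ae_of_all _ fun x => sq_nonneg _)]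
  exact hfin

lemma integral_sq_le_of_lintegral_sq_le {f : α → ℝ} (hf : AEStronglyMeasurable f μ) {C : ℝ}
    (hC : 0 ≤ C) (hfC : ∫⁻ x, ENNReal.ofReal (f x ^ 2) ∂μ ≤ ENNReal.ofReal C) :
    ∫ x, f x ^ 2 ∂μ ≤ C := by
  rw [integral_eq_lintegral_of_nonneg_ae (ae_of_all _ fun x => sq_nonneg _) (hf.pow 2)]
  exact ENNReal.toReal_le_of_le_ofReal hC hfC

lemma sq_integral_le_integral_sq [IsProbabilityMeasure μ] {f : α → ℝ} (hf : MemLp f 2 μ) :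
    (∫ x, f x ∂μ) ^ 2 ≤ ∫ x, f x ^ 2 ∂μ := by
  have h1 := variance_eq_sub hf
  have h2 := variance_nonneg f μ
  simp only [Pi.pow_apply] at h1
  linarith

/-- Jensen's inequality. No integrability is needed: when the right side is infinite there is
nothing to prove. -/
lemma ofReal_sq_integral_le_lintegral [IsProbabilityMeasure μ] {f : α → ℝ}
    (hf : AEStronglyMeasurable f μ) :
    ENNReal.ofReal ((∫ x, f x ∂μ) ^ 2) ≤ ∫⁻ x, ENNReal.ofReal (f x ^ 2) ∂μ := by
  by_cases hfin : ∫⁻ x, ENNReal.ofReal (f x ^ 2) ∂μ < ⊤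
  · have hL := memLp_two_of_lintegral_sq_lt_top hf hfin
    rw [← ofReal_integral_eq_lintegral_ofReal hL.integrable_sq
      (ae_of_all _ fun x => sq_nonneg _)]
    exact ENNReal.ofReal_le_ofReal (sq_integral_le_integral_sq hL)
  · rw [not_lt, top_le_iff] at hfin
    rw [hfin]
    exact le_top

/-- Jensen's inequality for `f ^ 2`. It converts the fourth-moment bound `M` into the second-moment
bound `√M` used in the rates. -/
lemma lintegral_sq_le_of_lintegral_pow_four_le [IsProbabilityMeasure μ] {f : α → ℝ}
    (hf : AEStronglyMeasurable f μ) {M : ℝ} (hM : 0 ≤ M)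
    (hfM : ∫⁻ x, ENNReal.ofReal (f x ^ 4) ∂μ ≤ ENNReal.ofReal M) :
    ∫⁻ x, ENNReal.ofReal (f x ^ 2) ∂μ ≤ ENNReal.ofReal (√M) := by
  have hfM' : ∫⁻ x, ENNReal.ofReal ((f x ^ 2) ^ 2) ∂μ ≤ ENNReal.ofReal M := by
    simpa only [← pow_mul] using hfM
  have hL : MemLp (fun x => f x ^ 2) 2 μ := memLp_two_of_lintegral_sq_lt_top (hf.pow 2)
    (hfM'.trans_lt ENNReal.ofReal_lt_top)
  rw [← ofReal_integral_eq_lintegral_ofReal (hL.integrable (by norm_num))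
      (ae_of_all _ fun x => sq_nonneg _)]
  refine ENNReal.ofReal_le_ofReal (Real.le_sqrt_of_sq_le ?_)
  exact (sq_integral_le_integral_sq hL).trans
    (integral_sq_le_of_lintegral_sq_le (hf.pow 2) hM hfM')

/-- Both factors have the same bound `C`, so |fg| ≤ (f² + g²)/2 pointwise does the work of
Cauchy–Schwarz. -/
lemma abs_integral_mul_le_of_integral_sq_le {f g : α → ℝ} {C : ℝ} (hf : MemLp f 2 μ)
    (hg : MemLp g 2 μ) (hfC : ∫ x, f x ^ 2 ∂μ ≤ C) (hgC : ∫ x, g x ^ 2 ∂μ ≤ C) :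
    |∫ x, f x * g x ∂μ| ≤ C := by
  have hfi := hf.integrable_sq
  have hgi := hg.integrable_sq
  have hfg : Integrable (fun x => f x * g x) μ := hf.integrable_mul hg
  have key : ∫ x, |f x * g x| ∂μ ≤ ∫ x, (f x ^ 2 + g x ^ 2) / 2 ∂μ := by
    refine integral_mono hfg.abs ((hfi.add hgi).div_const 2) fun x => ?_
    simp only [abs_mul]
    nlinarith [sq_nonneg (|f x| - |g x|), sq_abs (f x), sq_abs (g x)]
  rw [integral_div, integral_add hfi hgi] at key
  have := abs_integral_le_integral_abs (f := fun x => f x * g x) (μ := μ)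
  linarith

lemma abs_covariance_le_of_integral_sq_le [IsProbabilityMeasure μ] {f g : α → ℝ} {C : ℝ}
    (hf : MemLp f 2 μ) (hg : MemLp g 2 μ) (hfC : ∫ x, f x ^ 2 ∂μ ≤ C)
    (hgC : ∫ x, g x ^ 2 ∂μ ≤ C) : |cov[f, g; μ]| ≤ C := by
  -- Centring does not increase a second moment.
  have hsq : ∀ u : α → ℝ, MemLp u 2 μ → ∫ x, u x ^ 2 ∂μ ≤ C →
      ∫ x, (u x - ∫ y, u y ∂μ) ^ 2 ∂μ ≤ C := by
    intro u hu huC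
    have h1 := variance_eq_sub hu
    have h2 := variance_eq_integral hu.aestronglyMeasurable.aemeasurable
    simp only [Pi.pow_apply] at h1
    nlinarith [sq_nonneg (∫ y, u y ∂μ)]
  exact abs_integral_mul_le_of_integral_sq_le (hf.sub (memLp_const _)) (hg.sub (memLp_const _))
    (hsq f hf hfC) (hsq g hg hgC)

end SecondMoments

/-! ### Inserting and removing one coordinate -/

section InsertNth

variable {𝒳 : Type*} [MeasurableSpace 𝒳] {n d : ℕ}

lemma measurable_insertNth {α : Type*} [MeasurableSpace α] (l : Fin (d + 1)) {f : α → 𝒳}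
    {g : α → Fin d → 𝒳} (hf : Measurable f) (hg : Measurable g) :
    Measurable fun z => (l.insertNth (f z) (g z) : Fin (d + 1) → 𝒳) :=
  (MeasurableEquiv.piFinSuccAbove (fun _ => 𝒳) l).symm.measurable.comp (hf.prodMk hg)

lemma insertNth_comp {α β : Type*} (u : α → β) (l : Fin (d + 1)) (t : α) (r : Fin d → α) :
    (fun k => u ((l.insertNth t r : Fin (d + 1) → α) k))
      = l.insertNth (u t) (fun k => u (r k)) := by
  ext k
  refine Fin.succAboveCases l ?_ (fun k => ?_) k <;> simp

lemma insertNth_injective {α : Type*} {l : Fin (d + 1)} {t : α} {r : Fin d → α}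
    (hr : Function.Injective r) (ht : ∀ k, r k ≠ t) :
    Function.Injective (l.insertNth t r : Fin (d + 1) → α) := by
  intro a b
  refine Fin.succAboveCases l ?_ (fun a => ?_) a <;> refine Fin.succAboveCases l ?_ (fun b => ?_) b
  · simp
  · simpa using fun h => (ht b h.symm).elim
  · simpa using fun h => (ht a h).elim
  · simpa using fun h => hr h

lemma removeNth_injective {α : Type*} {l : Fin (d + 1)} {i : Fin (d + 1) → α}
    (hi : Function.Injective i) : Function.Injective (l.removeNth i) :=
  fun _ _ hab => Fin.succAbove_right_injective (hi hab)

lemma removeNth_ne {α : Type*} {l : Fin (d + 1)} {i : Fin (d + 1) → α}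
    (hi : Function.Injective i) (k : Fin d) : l.removeNth i k ≠ i l :=
  fun hab => Fin.succAbove_ne l k (hi hab)

lemma mem_distinctTuples {m : ℕ} {i : Fin m → Fin n} :
    i ∈ distinctTuples n m ↔ Function.Injective i := by
  simp [distinctTuples]

lemma measurable_condKernel (Q : Fin n → Measure 𝒳) [∀ i, IsProbabilityMeasure (Q i)]
    {h : (Fin (d + 1) → 𝒳) → ℝ} (hh : Measurable h) (l : Fin (d + 1)) (j : Fin d → Fin n) :
    Measurable (condKernel Q h l j) := by
  refine (StronglyMeasurable.integral_prod_right (f := fun x y => h (l.insertNth x y)) ?_).measurable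
  exact (hh.comp (measurable_insertNth l measurable_fst measurable_snd)).stronglyMeasurable

lemma measurable_h1 (Q : Fin n → Measure 𝒳) [∀ i, IsProbabilityMeasure (Q i)]
    (a : (Fin (d + 1) → Fin n) → ℝ) {h : (Fin (d + 1) → 𝒳) → ℝ} (hh : Measurable h) (t : Fin n) :
    Measurable (h1 Q a h t) := by
  unfold h1
  refine Measurable.const_mul (Finset.measurable_sum _ fun j _ =>
    Finset.measurable_sum _ fun l _ => ?_) _
  exact ((measurable_condKernel Q hh l j).sub_const _).const_mul _

/-- Jensen in the integrated arguments for each fixed `x`. As `ν` is arbitrary, `x` may also be an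
independent copy of one of the integrated variables. -/
lemma lintegral_sq_condKernel_le (Q : Fin n → Measure 𝒳) [∀ i, IsProbabilityMeasure (Q i)]
    {h : (Fin (d + 1) → 𝒳) → ℝ} (hh : Measurable h) (l : Fin (d + 1)) (j : Fin d → Fin n)
    (ν : Measure 𝒳) :
    ∫⁻ x, ENNReal.ofReal (condKernel Q h l j x ^ 2) ∂ν ≤
      ∫⁻ x, ∫⁻ y : Fin d → 𝒳, ENNReal.ofReal (h (l.insertNth x y) ^ 2)
        ∂(Measure.pi fun k => Q (j k)) ∂ν := by
  refine lintegral_mono fun x => ofReal_sq_integral_le_lintegral ?_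
  exact (hh.comp (measurable_insertNth l measurable_const measurable_id)).aestronglyMeasurable

end InsertNth

/-! ### Integrating out an independent block of variables -/

section Freezing

variable {Ω 𝒳 : Type*} [MeasurableSpace Ω] [MeasurableSpace 𝒳] {n d : ℕ}
  {P : Measure Ω} {X : Fin n → Ω → 𝒳}

lemma indepFun_subtuple {κ κ' : Type*} (hX : ∀ i, Measurable (X i)) (hind : iIndepFun X P)
    {j : κ → Fin n} {s : κ' → Fin n} (hjs : ∀ k k', j k ≠ s k') :
    IndepFun (fun ω k => X (j k) ω) (fun ω k => X (s k) ω) P := by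
  classical
  let S : Finset (Fin n) := Finset.univ.filter fun c => c ∈ Set.range j
  let T : Finset (Fin n) := Finset.univ.filter fun c => c ∈ Set.range s
  have hST : Disjoint S T := by
    rw [Finset.disjoint_left]
    intro c hc hc'
    simp only [S, T, Finset.mem_filter, Finset.mem_univ, true_and, Set.mem_range] at hc hc'
    obtain ⟨k, rfl⟩ := hc
    obtain ⟨k', hk'⟩ := hc'
    exact hjs k k' hk'.symm
  have hS : ∀ k, j k ∈ S := fun k => by simp [S]
  have hT : ∀ k, s k ∈ T := fun k => by simp [T]
  have hφ : Measurable fun (z : S → 𝒳) k => z ⟨j k, hS k⟩ := by fun_prop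
  have hψ : Measurable fun (z : T → 𝒳) k => z ⟨s k, hT k⟩ := by fun_prop
  exact (hind.indepFun_finset S T hST hX).comp hφ hψ

variable [IsProbabilityMeasure P]

lemma isProbabilityMeasure_laws (hX : ∀ i, Measurable (X i)) (i : Fin n) :
    IsProbabilityMeasure (laws P X i) :=
  Measure.isProbabilityMeasure_map (hX i).aemeasurable

lemma map_subtuple {κ : Type*} [Fintype κ] (hX : ∀ i, Measurable (X i)) (hind : iIndepFun X P)
    {j : κ → Fin n} (hj : Function.Injective j) :
    P.map (fun ω k => X (j k) ω) = Measure.pi fun k => laws P X (j k) :=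
  (iIndepFun_iff_map_fun_eq_pi_map fun k => (hX (j k)).aemeasurable).1 (hind.precomp hj)

lemma map_prodMk_subtuple {κ : Type*} (hX : ∀ i, Measurable (X i))
    (hind : iIndepFun X P) {j : Fin d → Fin n} (hj : Function.Injective j) {s : κ → Fin n}
    (hjs : ∀ k k', j k ≠ s k') :
    P.map (fun ω => ((fun k => X (j k) ω), fun k => X (s k) ω))
      = (Measure.pi fun k => laws P X (j k)).prod (P.map fun ω k => X (s k) ω) := by
  rw [← map_subtuple hX hind hj]
  refine (indepFun_iff_map_prod_eq_prod_map_map ?_ ?_).1 (indepFun_subtuple hX hind hjs)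
  · exact (measurable_pi_lambda _ fun k => hX (j k)).aemeasurable
  · exact (measurable_pi_lambda _ fun k => hX (s k)).aemeasurable

/-- Given the block `s`, a disjoint block `j` of distinct indices keeps its product law and can be
integrated first. Repetitions inside `s` are harmless, since only the joint law of that block
enters. -/
lemma lintegral_freeze {κ : Type*} (hX : ∀ i, Measurable (X i))
    (hind : iIndepFun X P) {j : Fin d → Fin n} (hj : Function.Injective j) {s : κ → Fin n}
    (hjs : ∀ k k', j k ≠ s k') {Φ : (Fin d → 𝒳) → (κ → 𝒳) → ℝ≥0∞}
    (hΦ : Measurable (Function.uncurry Φ)) :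
    ∫⁻ ω, Φ (fun k => X (j k) ω) (fun k => X (s k) ω) ∂P
      = ∫⁻ ω, ∫⁻ y, Φ y (fun k => X (s k) ω) ∂(Measure.pi fun k => laws P X (j k)) ∂P := by
  have := fun i => isProbabilityMeasure_laws (P := P) hX i
  have hXs : Measurable fun ω k => X (s k) ω := measurable_pi_lambda _ fun k => hX (s k)
  have hXj : Measurable fun ω k => X (j k) ω := measurable_pi_lambda _ fun k => hX (j k)
  have : IsProbabilityMeasure (P.map fun ω k => X (s k) ω) :=
    Measure.isProbabilityMeasure_map hXs.aemeasurable
  calc ∫⁻ ω, Φ (fun k => X (j k) ω) (fun k => X (s k) ω) ∂P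
      = ∫⁻ z, Function.uncurry Φ z
          ∂(P.map fun ω => ((fun k => X (j k) ω), fun k => X (s k) ω)) := by
        rw [lintegral_map hΦ (hXj.prodMk hXs)]; rfl
    _ = ∫⁻ w, ∫⁻ y, Φ y w ∂(Measure.pi fun k => laws P X (j k))
          ∂(P.map fun ω k => X (s k) ω) := by
        rw [map_prodMk_subtuple hX hind hj hjs, lintegral_prod_symm _ hΦ.aemeasurable]; rfl
    _ = _ := by
        rw [lintegral_map hΦ.lintegral_prod_left hXs]

lemma integral_freeze {κ : Type*} (hX : ∀ i, Measurable (X i))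
    (hind : iIndepFun X P) {j : Fin d → Fin n} (hj : Function.Injective j) {s : κ → Fin n}
    (hjs : ∀ k k', j k ≠ s k') {Φ : (Fin d → 𝒳) → (κ → 𝒳) → ℝ}
    (hΦ : Measurable (Function.uncurry Φ))
    (hint : Integrable (fun ω => Φ (fun k => X (j k) ω) (fun k => X (s k) ω)) P) :
    ∫ ω, Φ (fun k => X (j k) ω) (fun k => X (s k) ω) ∂P
      = ∫ ω, ∫ y, Φ y (fun k => X (s k) ω) ∂(Measure.pi fun k => laws P X (j k)) ∂P := by
  have := fun i => isProbabilityMeasure_laws (P := P) hX i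
  have hXs : Measurable fun ω k => X (s k) ω := measurable_pi_lambda _ fun k => hX (s k)
  have hXj : Measurable fun ω k => X (j k) ω := measurable_pi_lambda _ fun k => hX (j k)
  have : IsProbabilityMeasure (P.map fun ω k => X (s k) ω) :=
    Measure.isProbabilityMeasure_map hXs.aemeasurable
  have hΦs := hΦ.stronglyMeasurable
  have hint' : Integrable (Function.uncurry Φ)
      (P.map fun ω => ((fun k => X (j k) ω), fun k => X (s k) ω)) :=
    (integrable_map_measure hΦs.aestronglyMeasurable (hXj.prodMk hXs).aemeasurable).2 hint
  calc ∫ ω, Φ (fun k => X (j k) ω) (fun k => X (s k) ω) ∂P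
      = ∫ z, Function.uncurry Φ z
          ∂(P.map fun ω => ((fun k => X (j k) ω), fun k => X (s k) ω)) := by
        rw [integral_map (hXj.prodMk hXs).aemeasurable hΦs.aestronglyMeasurable]; rfl
    _ = ∫ w, ∫ y, Φ y w ∂(Measure.pi fun k => laws P X (j k))
          ∂(P.map fun ω k => X (s k) ω) := by
        rw [map_prodMk_subtuple hX hind hj hjs] at hint' ⊢
        rw [integral_prod_symm _ hint']; rfl
    _ = _ := by
        rw [integral_map hXs.aemeasurable]
        exact (StronglyMeasurable.integral_prod_left (f := Φ) hΦs).aestronglyMeasurable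

/-- Arguments of the kernel that are independent of the other factor can be integrated out. -/
lemma integral_kernel_mul_eq {κ : Type*} (hX : ∀ i, Measurable (X i))
    (hind : iIndepFun X P) {h : (Fin (d + 1) → 𝒳) → ℝ} (hh : Measurable h) (l : Fin (d + 1))
    {r : Fin d → Fin n} (hr : Function.Injective r) {s : κ → Fin n}
    (hrs : ∀ k k', r k ≠ s k') (q : κ) {g : (κ → 𝒳) → ℝ} (hg : Measurable g)
    (hint : Integrable (fun ω => h (fun k => X ((l.insertNth (s q) r : Fin (d + 1) → Fin n) k) ω)
      * g (fun k => X (s k) ω)) P) :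
    ∫ ω, h (fun k => X ((l.insertNth (s q) r : Fin (d + 1) → Fin n) k) ω)
        * g (fun k => X (s k) ω) ∂P
      = ∫ ω, condKernel (laws P X) h l r (X (s q) ω) * g (fun k => X (s k) ω) ∂P := by
  have e : ∀ ω, (fun k => X ((l.insertNth (s q) r : Fin (d + 1) → Fin n) k) ω)
      = l.insertNth (X (s q) ω) (fun k => X (r k) ω) :=
    fun ω => insertNth_comp (fun t => X t ω) l (s q) r
  simp only [e] at hint ⊢
  rw [integral_freeze hX hind hr hrs (Φ := fun y z => h (l.insertNth (z q) y) * g z) ?_ hint]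
  · simp only [integral_mul_const, condKernel]
  · refine (hh.comp (measurable_insertNth l ?_ measurable_fst)).mul (hg.comp measurable_snd)
    exact (measurable_pi_apply q).comp measurable_snd

lemma lintegral_kernel_sq_eq (hX : ∀ i, Measurable (X i))
    (hind : iIndepFun X P) {h : (Fin (d + 1) → 𝒳) → ℝ} (hh : Measurable h) (l : Fin (d + 1))
    {r : Fin d → Fin n} (hr : Function.Injective r) {t : Fin n} (ht : ∀ k, r k ≠ t) :
    ∫⁻ ω, ENNReal.ofReal (h (fun k => X ((l.insertNth t r : Fin (d + 1) → Fin n) k) ω) ^ 2) ∂P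
      = ∫⁻ x, ∫⁻ y : Fin d → 𝒳, ENNReal.ofReal (h (l.insertNth x y) ^ 2)
        ∂(Measure.pi fun k => laws P X (r k)) ∂(laws P X t) := by
  have := fun i => isProbabilityMeasure_laws (P := P) hX i
  have e : ∀ ω, (fun k => X ((l.insertNth t r : Fin (d + 1) → Fin n) k) ω)
      = l.insertNth (X t ω) (fun k => X (r k) ω) :=
    fun ω => insertNth_comp (fun t => X t ω) l t r
  simp only [e]
  rw [lintegral_freeze hX hind hr (s := fun _ : Unit => t) (fun k _ => ht k)
    (Φ := fun y z => ENNReal.ofReal (h (l.insertNth (z ()) y) ^ 2))]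
  · unfold laws
    rw [lintegral_map _ (hX t)]
    refine Measurable.lintegral_prod_right
      (f := fun x y => ENNReal.ofReal (h (l.insertNth x y) ^ 2)) ?_
    exact ((hh.comp (measurable_insertNth l measurable_fst measurable_snd)).pow_const 2).ennreal_ofReal
  · refine ((hh.comp (measurable_insertNth l ?_ measurable_fst)).pow_const 2).ennreal_ofReal
    exact (measurable_pi_apply ()).comp measurable_snd

/-- Second moments of the projections of the kernel are dominated by those of the kernel. -/
lemma lintegral_sq_condKernel_le_of_ne (hX : ∀ i, Measurable (X i))
    (hind : iIndepFun X P) {h : (Fin (d + 1) → 𝒳) → ℝ} (hh : Measurable h) (l : Fin (d + 1))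
    {r : Fin d → Fin n} (hr : Function.Injective r) {t : Fin n} (ht : ∀ k, r k ≠ t) :
    ∫⁻ ω, ENNReal.ofReal (condKernel (laws P X) h l r (X t ω) ^ 2) ∂P ≤
      ∫⁻ ω, ENNReal.ofReal
        (h (fun k => X ((l.insertNth t r : Fin (d + 1) → Fin n) k) ω) ^ 2) ∂P := by
  have := fun i => isProbabilityMeasure_laws (P := P) hX i
  rw [lintegral_kernel_sq_eq hX hind hh l hr ht]
  refine le_trans (le_of_eq ?_) (lintegral_sq_condKernel_le _ hh l r _)
  rw [laws, lintegral_map _ (hX t)]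
  exact ((measurable_condKernel _ hh l r).pow_const 2).ennreal_ofReal

end Freezing

/-! ### Counting index tuples in general position -/

section Counting

variable {n : ℕ} {ι : Type*} [Fintype ι] [DecidableEq ι]

/-- The multiplied form avoids division and subtraction in the exponent. -/
lemma card_filter_prescribed_mul (T : Finset ι) (v : ι → Fin n) :
    (Finset.univ.filter fun g : ι → Fin n => ∀ b ∈ T, g b = v b).card * n ^ T.card
      = n ^ Fintype.card ι := by
  have e : (Finset.univ.filter fun g : ι → Fin n => ∀ b ∈ T, g b = v b)
      = Fintype.piFinset fun b => if b ∈ T then {v b} else Finset.univ := by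
    ext g
    simp only [Finset.mem_filter, Finset.mem_univ, true_and, Fintype.mem_piFinset]
    refine forall_congr' fun b => ?_
    by_cases hb : b ∈ T <;> simp [hb]
  have e2 : ∀ b, (if b ∈ T then {v b} else (Finset.univ : Finset (Fin n))).card
      = if b ∈ T then 1 else n := by
    intro b
    by_cases hb : b ∈ T <;> simp [hb]
  rw [e, Fintype.card_piFinset]
  simp only [e2]
  rw [Finset.prod_ite, Finset.prod_const_one, one_mul, Finset.prod_const, ← pow_add]
  congr 1
  rw [Finset.filter_not, Finset.filter_mem_eq_inter, Finset.univ_inter,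
    ← Finset.compl_eq_univ_sdiff, Finset.card_compl]
  exact Nat.sub_add_cancel (Finset.card_le_univ T)

lemma card_filter_apply_eq_mul (b : ι) (v : Fin n) :
    (Finset.univ.filter fun g : ι → Fin n => g b = v).card * n = n ^ Fintype.card ι := by
  simpa using card_filter_prescribed_mul {b} (fun _ => v)

/-- Split by the common value: `n` choices, each prescribing two coordinates. -/
lemma card_filter_apply_eq_apply_mul_le {b c : ι} (hbc : b ≠ c) :
    (Finset.univ.filter fun g : ι → Fin n => g b = g c).card * n ≤ n ^ Fintype.card ι := by
  rcases Nat.eq_zero_or_pos n with rfl | hn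
  · simp
  have h1 : (Finset.univ.filter fun g : ι → Fin n => g b = g c).card ≤
      ∑ v : Fin n, (Finset.univ.filter fun g : ι → Fin n => ∀ e ∈ ({b, c} : Finset ι), g e = v).card := by
    refine le_trans (Finset.card_le_card ?_) Finset.card_biUnion_le
    intro g hg
    simp only [Finset.mem_filter, Finset.mem_univ, true_and] at hg
    simp [hg]
  have h2 : ∀ v : Fin n, (Finset.univ.filter fun g : ι → Fin n =>
      ∀ e ∈ ({b, c} : Finset ι), g e = v).card * n ^ 2 = n ^ Fintype.card ι := by
    intro v
    have := card_filter_prescribed_mul {b, c} (fun _ => v)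
    rwa [Finset.card_pair hbc] at this
  have h3 : (Finset.univ.filter fun g : ι → Fin n => g b = g c).card * n ^ 2
      ≤ n * n ^ Fintype.card ι := by
    refine (Nat.mul_le_mul_right _ h1).trans ?_
    rw [Finset.sum_mul, Finset.sum_congr rfl fun v _ => h2 v]
    simp
  refine Nat.le_of_mul_le_mul_left ?_ hn
  calc _ = (Finset.univ.filter fun g : ι → Fin n => g b = g c).card * n ^ 2 := by ring
    _ ≤ _ := h3

open Classical in
/-- Index tuples with a repetition, or hitting a given set, are rare. -/
lemma card_filter_not_generic_mul_le (S : Finset (Fin n)) :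
    (Finset.univ.filter fun g : ι → Fin n => ¬ (Function.Injective g ∧ ∀ b, g b ∉ S)).card * n
      ≤ (Fintype.card ι ^ 2 + Fintype.card ι * S.card) * n ^ Fintype.card ι := by
  have hsub : (Finset.univ.filter fun g : ι → Fin n => ¬ (Function.Injective g ∧ ∀ b, g b ∉ S)) ⊆
      ((Finset.univ.filter fun p : ι × ι => p.1 ≠ p.2).biUnion fun p =>
        Finset.univ.filter fun g : ι → Fin n => g p.1 = g p.2) ∪
      ((Finset.univ ×ˢ S).biUnion fun p : ι × Fin n =>
        Finset.univ.filter fun g : ι → Fin n => g p.1 = p.2) := by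
    intro g hg
    simp only [Finset.mem_filter, Finset.mem_univ, true_and, not_and_or] at hg
    rw [Finset.mem_union]
    rcases hg with hg | hg
    · left
      simp only [Function.Injective, not_forall] at hg
      obtain ⟨b, c, hbc, hne⟩ := hg
      simp only [Finset.mem_biUnion, Finset.mem_filter, Finset.mem_univ, true_and]
      exact ⟨(b, c), hne, hbc⟩
    · right
      push Not at hg
      obtain ⟨b, hb⟩ := hg
      simp only [Finset.mem_biUnion, Finset.mem_filter, Finset.mem_univ, true_and,
        Finset.mem_product]
      exact ⟨(b, g b), hb, rfl⟩
  have hcard := (Finset.card_le_card hsub).trans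
    ((Finset.card_union_le _ _).trans (add_le_add Finset.card_biUnion_le Finset.card_biUnion_le))
  refine (Nat.mul_le_mul_right n hcard).trans ?_
  rw [add_mul, add_mul, Finset.sum_mul, Finset.sum_mul]
  -- At most |ι|² pairs of positions can collide, and there are |ι|·|S| ways for a position to take
  -- a forbidden value; each such event has a proportion at most 1/n.
  refine add_le_add ?_ ?_
  · refine (Finset.sum_le_card_nsmul _ _ (n ^ Fintype.card ι) ?_).trans ?_
    · intro p hp
      simp only [Finset.mem_filter, Finset.mem_univ, true_and] at hp
      exact card_filter_apply_eq_apply_mul_le hp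
    · rw [smul_eq_mul]
      refine Nat.mul_le_mul_right _ ((Finset.card_le_univ _).trans ?_)
      simp [sq]
  · refine (Finset.sum_le_card_nsmul _ _ (n ^ Fintype.card ι) ?_).trans ?_
    · intro p _
      exact (card_filter_apply_eq_mul p.1 p.2).le
    · simp

/-- Tuples outside general position are a fraction O(1/n), so the crude bound `C` costs only O(C/n)
there and `B` governs the rest. -/
lemma abs_average_le_of_generic (hn : 0 < n) (S : Finset (Fin n)) (F : (ι → Fin n) → ℝ) {B C : ℝ} (hB : 0 ≤ B)
    (hC : 0 ≤ C) (hall : ∀ g, |F g| ≤ C)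
    (hgen : ∀ g, Function.Injective g → (∀ b, g b ∉ S) → |F g| ≤ B) :
    |((n : ℝ) ^ Fintype.card ι)⁻¹ * ∑ g, F g|
      ≤ B + C * (Fintype.card ι ^ 2 + Fintype.card ι * S.card) * (n : ℝ)⁻¹ := by
  classical
  have hn' : (0 : ℝ) < n := by exact_mod_cast hn
  set N : ℝ := (n : ℝ) ^ Fintype.card ι with hN
  have hNpos : 0 < N := by positivity
  set bad := Finset.univ.filter fun g : ι → Fin n => ¬ (Function.Injective g ∧ ∀ b, g b ∉ S)
    with hbad
  have hbadcard : (bad.card : ℝ) ≤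
      (Fintype.card ι ^ 2 + Fintype.card ι * S.card) * N * (n : ℝ)⁻¹ := by
    rw [le_mul_inv_iff₀ hn']
    have := card_filter_not_generic_mul_le (ι := ι) S
    rw [hN]
    exact_mod_cast this
  have hsum : |∑ g, F g| ≤ N * B + bad.card * C := by
    refine (Finset.abs_sum_le_sum_abs _ _).trans ?_
    have h1 : ∀ g ∈ Finset.univ, |F g| ≤ B + if g ∈ bad then C else 0 := by
      intro g _
      by_cases hg : g ∈ bad
      · simpa [hg] using (hall g).trans (by linarith)
      · simp only [hg, if_false, add_zero]
        simp only [hbad, Finset.mem_filter, Finset.mem_univ, true_and, not_not] at hg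
        exact hgen g hg.1 hg.2
    refine (Finset.sum_le_sum h1).trans (le_of_eq ?_)
    rw [Finset.sum_add_distrib, Finset.sum_ite_mem]
    simp [hN]
  rw [abs_mul, abs_of_pos (inv_pos.2 hNpos), inv_mul_le_iff₀ hNpos]
  refine hsum.trans ?_
  have := mul_le_mul_of_nonneg_right hbadcard hC
  calc _ ≤ N * B + (Fintype.card ι ^ 2 + Fintype.card ι * S.card) * N * (n : ℝ)⁻¹ * C := by
        linarith
    _ = _ := by ring

end Counting

/-! ### Pairs of tuples, by number of common indices -/

section Sharing

variable {n m : ℕ}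

/-- The sum of the absolute weights of the pairs of tuples with at least `q` common indices. -/
def shareSum (a : (Fin m → Fin n) → ℝ) (q : ℕ) : ℝ :=
  ∑ t ∈ sharing n m 2 q, |∏ k, a (t k)|

lemma shareSum_nonneg (a : (Fin m → Fin n) → ℝ) (q : ℕ) : 0 ≤ shareSum a q :=
  Finset.sum_nonneg fun _ _ => abs_nonneg _

lemma avgWeight_nonneg (a : (Fin m → Fin n) → ℝ) (K q : ℕ) : 0 ≤ avgWeight a K q :=
  mul_nonneg (by positivity) (Finset.sum_nonneg fun _ _ => abs_nonneg _)

lemma shareSum_eq (a : (Fin m → Fin n) → ℝ) (q : ℕ) :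
    shareSum a q = (sharing n m 2 q).card * avgWeight a 2 q := by
  unfold shareSum avgWeight
  rcases Finset.eq_empty_or_nonempty (sharing n m 2 q) with he | hne
  · simp [he]
  · rw [mul_inv_cancel_left₀]
    exact_mod_cast hne.card_pos.ne'

lemma shareSum_two_le_one (a : (Fin m → Fin n) → ℝ) : shareSum a 2 ≤ shareSum a 1 := by
  refine Finset.sum_le_sum_of_subset_of_nonneg ?_ fun _ _ _ => abs_nonneg _
  intro t ht
  simp only [sharing, Finset.mem_filter, Finset.mem_univ, true_and] at ht ⊢
  exact ⟨ht.1, by omega⟩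

/-- Each pair is treated by its number of common indices: none, exactly one, or at least two.
Charging the last kind to both sums on the right is harmless. -/
lemma abs_sum_sum_mul_le (a : (Fin m → Fin n) → ℝ) (K : (Fin m → Fin n) → (Fin m → Fin n) → ℝ)
    {B₁ B₂ : ℝ} (hB₁ : 0 ≤ B₁) (hB₂ : 0 ≤ B₂)
    (hzero : ∀ i ∈ distinctTuples n m, ∀ j ∈ distinctTuples n m, (∀ p q, i p ≠ j q) → K i j = 0)
    (hone : ∀ i ∈ distinctTuples n m, ∀ j ∈ distinctTuples n m, ∀ p q, i p = j q →
      (∀ p' q', i p' = j q' → p' = p ∧ q' = q) → |K i j| ≤ B₁)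
    (htwo : ∀ i ∈ distinctTuples n m, ∀ j ∈ distinctTuples n m, |K i j| ≤ B₂) :
    |∑ i ∈ distinctTuples n m, ∑ j ∈ distinctTuples n m, a i * a j * K i j|
      ≤ B₁ * shareSum a 1 + B₂ * shareSum a 2 := by
  classical
  have key : ∀ i j : Fin m → Fin n,
      |if i ∈ distinctTuples n m then if j ∈ distinctTuples n m then a i * a j * K i j else 0
        else 0| ≤
      (if ![i, j] ∈ sharing n m 2 1 then B₁ * |∏ k, a (![i, j] k)| else 0) +
      (if ![i, j] ∈ sharing n m 2 2 then B₂ * |∏ k, a (![i, j] k)| else 0) := by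
    intro i j
    have hr : 0 ≤ (if ![i, j] ∈ sharing n m 2 1 then B₁ * |∏ k, a (![i, j] k)| else 0) +
      (if ![i, j] ∈ sharing n m 2 2 then B₂ * |∏ k, a (![i, j] k)| else 0) := by
      refine add_nonneg ?_ ?_ <;> split_ifs <;> positivity
    by_cases hi : i ∈ distinctTuples n m
    swap
    · simpa only [hi, if_false, abs_zero] using hr
    by_cases hj : j ∈ distinctTuples n m
    swap
    · simpa only [hi, hj, if_true, if_false, abs_zero] using hr
    simp only [hi, hj, if_true]
    by_cases h0 : ∀ p q, i p ≠ j q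
    · rw [hzero i hi j hj h0, mul_zero, abs_zero]
      exact hr
    push Not at h0
    obtain ⟨p, q, hpq⟩ := h0
    have hi' := mem_distinctTuples.1 hi
    have hj' := mem_distinctTuples.1 hj
    have hinj : ∀ k : Fin 2, Function.Injective (![i, j] k) := by
      rw [Fin.forall_fin_two]
      exact ⟨hi', hj'⟩
    have hmem : ∀ c : Fin n, c ∈ (Finset.univ.filter fun c : Fin n => ∀ k, ∃ l, ![i, j] k l = c)
        ↔ (∃ l, i l = c) ∧ ∃ l, j l = c := by
      intro c
      simp [Fin.forall_fin_two]
    have hprod : |∏ k, a (![i, j] k)| = |a i * a j| := by simp [Fin.prod_univ_two]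
    have h1 : ![i, j] ∈ sharing n m 2 1 := by
      simp only [sharing, Finset.mem_filter, Finset.mem_univ, true_and]
      refine ⟨hinj, Finset.card_pos.2 ⟨i p, (hmem _).2 ⟨⟨p, rfl⟩, q, hpq.symm⟩⟩⟩
    rw [hprod, abs_mul, mul_comm]
    by_cases hu : ∀ p' q', i p' = j q' → p' = p ∧ q' = q
    · rw [if_pos h1]
      have h2 : 0 ≤ (if ![i, j] ∈ sharing n m 2 2 then B₂ * |a i * a j| else 0) := by
        split_ifs <;> positivity
      have := mul_le_mul_of_nonneg_right (hone i hi j hj p q hpq hu) (abs_nonneg (a i * a j))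
      linarith
    · have h2 : ![i, j] ∈ sharing n m 2 2 := by
        simp only [sharing, Finset.mem_filter, Finset.mem_univ, true_and]
        refine ⟨hinj, Finset.one_lt_card.2 ?_⟩
        push Not at hu
        obtain ⟨p', q', hpq', hne⟩ := hu
        -- A coincidence at another pair of positions yields a second common index: equal values
        -- would force equal positions, as `i` and `j` are injective.
        refine ⟨i p, (hmem _).2 ⟨⟨p, rfl⟩, q, hpq.symm⟩, i p',
          (hmem _).2 ⟨⟨p', rfl⟩, q', hpq'.symm⟩, fun heq => ?_⟩
        have hpp : p = p' := hi' heq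
        exact hne hpp.symm (hj' (by rw [← hpq', ← heq, hpq]))
      rw [if_pos h1, if_pos h2]
      have := mul_le_mul_of_nonneg_right (htwo i hi j hj) (abs_nonneg (a i * a j))
      have h3 : 0 ≤ B₁ * |a i * a j| := by positivity
      linarith
  have hl : ∑ i ∈ distinctTuples n m, ∑ j ∈ distinctTuples n m, a i * a j * K i j =
      ∑ i, ∑ j, if i ∈ distinctTuples n m then
        if j ∈ distinctTuples n m then a i * a j * K i j else 0 else 0 := by
    have hu : ∀ (s : Finset (Fin m → Fin n)) (F : (Fin m → Fin n) → ℝ),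
        ∑ i ∈ s, F i = ∑ i, if i ∈ s then F i else 0 := fun s F => by
      rw [Finset.sum_ite_mem, Finset.univ_inter]
    rw [hu]
    refine Finset.sum_congr rfl fun i _ => ?_
    by_cases hi : i ∈ distinctTuples n m
    · simp only [hi, if_true]
      exact hu _ _
    · simp [hi]
  have hs : ∀ F : (Fin 2 → Fin m → Fin n) → ℝ, ∑ i, ∑ j, F ![i, j] = ∑ t, F t := by
    intro F
    rw [← Fintype.sum_prod_type' (f := fun i j => F ![i, j])]
    exact Fintype.sum_equiv (finTwoArrowEquiv _).symm _ _ fun _ => rfl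
  rw [hl]
  refine (Finset.abs_sum_le_sum_abs _ _).trans ((Finset.sum_le_sum fun i _ =>
    (Finset.abs_sum_le_sum_abs _ _).trans (Finset.sum_le_sum fun j _ => key i j)).trans
      (le_of_eq ?_))
  rw [hs fun t => (if t ∈ sharing n m 2 1 then B₁ * |∏ k, a (t k)| else 0) +
      (if t ∈ sharing n m 2 2 then B₂ * |∏ k, a (t k)| else 0)]
  rw [Finset.sum_add_distrib, Finset.sum_ite_mem, Finset.sum_ite_mem, Finset.univ_inter,
    Finset.univ_inter, shareSum, shareSum, Finset.mul_sum, Finset.mul_sum]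

/-- Choose the first tuple freely, then the positions of a common index in both tuples, then the
second tuple with one entry prescribed. -/
lemma card_sharing_one_mul_le : (sharing n m 2 1).card * n ≤ m ^ 2 * n ^ (2 * m) := by
  classical
  have hsub : sharing n m 2 1 ⊆
      (Finset.univ : Finset ((Fin m → Fin n) × (Fin m × Fin m))).biUnion fun z =>
        (Finset.univ.filter fun g : Fin m → Fin n => g z.2.2 = z.1 z.2.1).image
          fun g => ![z.1, g] := by
    intro t ht
    simp only [sharing, Finset.mem_filter, Finset.mem_univ, true_and] at ht
    obtain ⟨c, hc⟩ := Finset.card_pos.1 ht.2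
    simp only [Finset.mem_filter, Finset.mem_univ, true_and] at hc
    obtain ⟨p, hp⟩ := hc 0
    obtain ⟨q, hq⟩ := hc 1
    simp only [Finset.mem_biUnion, Finset.mem_univ, true_and, Finset.mem_image,
      Finset.mem_filter]
    refine ⟨(t 0, p, q), t 1, hq.trans hp.symm, ?_⟩
    ext k : 1
    fin_cases k <;> rfl
  have h1 := (Finset.card_le_card hsub).trans Finset.card_biUnion_le
  refine (Nat.mul_le_mul_right n h1).trans ?_
  rw [Finset.sum_mul]
  refine (Finset.sum_le_card_nsmul _ _ (n ^ m) fun z _ => ?_).trans ?_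
  · refine (Nat.mul_le_mul_right n Finset.card_image_le).trans ?_
    simpa using (card_filter_apply_eq_mul z.2.2 (z.1 z.2.1)).le
  · simp only [Finset.card_univ, Fintype.card_prod, Fintype.card_fun, Fintype.card_fin, smul_eq_mul]
    apply le_of_eq
    ring

/-- Two distinct common indices occupy distinct positions of the second tuple, so two of its entries
are prescribed, which gains `n ^ 2`. -/
lemma card_sharing_two_mul_le : (sharing n m 2 2).card * n ^ 2 ≤ m ^ 4 * n ^ (2 * m) := by
  classical
  have hsub : sharing n m 2 2 ⊆
      (Finset.univ.filter fun z : (Fin m → Fin n) × ((Fin m × Fin m) × (Fin m × Fin m)) =>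
          z.2.2.1 ≠ z.2.2.2).biUnion fun z =>
        (Finset.univ.filter fun g : Fin m → Fin n => ∀ e ∈ ({z.2.2.1, z.2.2.2} : Finset (Fin m)),
          g e = if e = z.2.2.1 then z.1 z.2.1.1 else z.1 z.2.1.2).image fun g => ![z.1, g] := by
    intro t ht
    simp only [sharing, Finset.mem_filter, Finset.mem_univ, true_and] at ht
    obtain ⟨c, hc, c', hc', hne⟩ := Finset.one_lt_card.1 ht.2
    simp only [Finset.mem_filter, Finset.mem_univ, true_and] at hc hc'
    obtain ⟨p, hp⟩ := hc 0
    obtain ⟨q, hq⟩ := hc 1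
    obtain ⟨p', hp'⟩ := hc' 0
    obtain ⟨q', hq'⟩ := hc' 1
    have hqq : q ≠ q' := by
      rintro rfl
      exact hne (hq.symm.trans hq')
    simp only [Finset.mem_biUnion, Finset.mem_univ, true_and, Finset.mem_image,
      Finset.mem_filter]
    refine ⟨(t 0, (p, p'), (q, q')), hqq, t 1, ?_, ?_⟩
    · intro e he
      simp only [Finset.mem_insert, Finset.mem_singleton] at he
      rcases he with rfl | rfl
      · simp [hq, hp]
      · simp [hqq.symm, hq', hp']
    · ext k : 1
      fin_cases k <;> rfl
  have h1 := (Finset.card_le_card hsub).trans Finset.card_biUnion_le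
  refine (Nat.mul_le_mul_right (n ^ 2) h1).trans ?_
  rw [Finset.sum_mul]
  refine (Finset.sum_le_card_nsmul _ _ (n ^ m) fun z hz => ?_).trans ?_
  · simp only [Finset.mem_filter, Finset.mem_univ, true_and] at hz
    refine (Nat.mul_le_mul_right _ Finset.card_image_le).trans ?_
    have := card_filter_prescribed_mul ({z.2.2.1, z.2.2.2} : Finset (Fin m))
      (fun e => if e = z.2.2.1 then z.1 z.2.1.1 else z.1 z.2.1.2)
    rw [Finset.card_pair hz, Fintype.card_fin] at this
    convert this.le
  · rw [smul_eq_mul]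
    refine (Nat.mul_le_mul_right _ (Finset.card_le_univ _)).trans (le_of_eq ?_)
    simp only [Fintype.card_prod, Fintype.card_fun, Fintype.card_fin]
    ring

/-- The quotient n!/(n - m)! has `m` factors, each at least n + 1 - m ≥ n/2. -/
lemma factorial_ratio_mul_pow_le (hnm : 2 * m ≤ n) :
    ((n - m)! : ℝ) / (n ! : ℝ) * (n : ℝ) ^ m ≤ 2 ^ m := by
  have hm : m ≤ n := by omega
  have h1 : n ≤ 2 * (n + 1 - m) := by omega
  have h2 : n ^ m ≤ 2 ^ m * n.descFactorial m := by
    calc n ^ m ≤ (2 * (n + 1 - m)) ^ m := Nat.pow_le_pow_left h1 m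
      _ = 2 ^ m * (n + 1 - m) ^ m := mul_pow _ _ _
      _ ≤ _ := Nat.mul_le_mul_left _ (Nat.pow_sub_le_descFactorial n m)
  have h3 : (n - m)! * n ^ m ≤ 2 ^ m * n ! := by
    rw [← Nat.factorial_mul_descFactorial hm]
    calc _ ≤ (n - m)! * (2 ^ m * n.descFactorial m) := Nat.mul_le_mul_left _ h2
      _ = _ := by ring
  rw [div_mul_eq_mul_div, div_le_iff₀ (by positivity)]
  exact_mod_cast h3

/-- The squared prefactor is O(n^(-2m)) and the pairs number O(n^(2m - q)), which leaves n^(-q)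
times the average weight. This is the passage from double sums to the assumed rates. -/
lemma factorial_ratio_sq_mul_shareSum_le (a : (Fin m → Fin n) → ℝ) {q k : ℕ} (hn : 0 < n)
    (hnm : 2 * m ≤ n) (hcard : (sharing n m 2 q).card * n ^ q ≤ k * n ^ (2 * m)) :
    (((n - m)! : ℝ) / (n ! : ℝ)) ^ 2 * shareSum a q
      ≤ 4 ^ m * k * (((n : ℝ) ^ q)⁻¹ * avgWeight a 2 q) := by
  have hA := avgWeight_nonneg a 2 q
  have hn' : (0 : ℝ) < n := by exact_mod_cast hn
  have h1 := factorial_ratio_mul_pow_le hnm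
  set c := ((n - m)! : ℝ) / (n ! : ℝ) with hc
  have hc0 : 0 ≤ c := by positivity
  have h2 : (c * (n : ℝ) ^ m) ^ 2 ≤ 4 ^ m := by
    calc (c * (n : ℝ) ^ m) ^ 2 ≤ (2 ^ m) ^ 2 := pow_le_pow_left₀ (by positivity) h1 2
      _ = 4 ^ m := by rw [← pow_mul, mul_comm, pow_mul]; norm_num
  have h3 : ((sharing n m 2 q).card : ℝ) * (n : ℝ) ^ q ≤ k * (n : ℝ) ^ (2 * m) := by
    exact_mod_cast hcard
  have h4 : c ^ 2 * (sharing n m 2 q).card * (n : ℝ) ^ q ≤ 4 ^ m * k := by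
    calc c ^ 2 * (sharing n m 2 q).card * (n : ℝ) ^ q
        = c ^ 2 * ((sharing n m 2 q).card * (n : ℝ) ^ q) := by ring
      _ ≤ c ^ 2 * (k * (n : ℝ) ^ (2 * m)) := by gcongr
      _ = (c * (n : ℝ) ^ m) ^ 2 * k := by ring
      _ ≤ _ := by gcongr
  have h5 : c ^ 2 * (sharing n m 2 q).card ≤ 4 ^ m * k * ((n : ℝ) ^ q)⁻¹ := by
    rwa [le_mul_inv_iff₀ (by positivity)]
  rw [shareSum_eq, ← mul_assoc, ← mul_assoc]
  exact mul_le_mul_of_nonneg_right h5 hA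

end Sharing

/-! ### The first order expansion as a sum over a fixed set of tuples -/

section Reindexing

variable {𝒳 : Type*} [MeasurableSpace 𝒳] {n d : ℕ}

/-- Insertion at position `l` is a bijection onto the distinct tuples with value `t` there. The
range of summation no longer depends on `t`, so it can be exchanged with the sum over `t`. -/
lemma sum_distinctTuplesAvoiding (l : Fin (d + 1)) (t : Fin n)
    (F : (Fin (d + 1) → Fin n) → (Fin d → Fin n) → ℝ) :
    ∑ j ∈ distinctTuplesAvoiding d t, F (l.insertNth t j) j
      = ∑ i ∈ distinctTuples n (d + 1), if i l = t then F i (l.removeNth i) else 0 := by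
  rw [← Finset.sum_filter]
  refine Finset.sum_bij' (fun j _ => (l.insertNth t j : Fin (d + 1) → Fin n))
    (fun i _ => l.removeNth i) ?_ ?_ ?_ ?_ ?_
  · intro j hj
    simp only [distinctTuplesAvoiding, Finset.mem_filter, Finset.mem_univ, true_and] at hj
    simp only [Finset.mem_filter, mem_distinctTuples, Fin.insertNth_apply_same, and_true]
    exact insertNth_injective hj.1 hj.2
  · intro i hi
    simp only [Finset.mem_filter, mem_distinctTuples] at hi
    simp only [distinctTuplesAvoiding, Finset.mem_filter, Finset.mem_univ, true_and]
    refine ⟨removeNth_injective hi.1, fun k => ?_⟩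
    rw [← hi.2]
    exact removeNth_ne hi.1 k
  · intro j _
    simp
  · intro i hi
    simp only [Finset.mem_filter] at hi
    rw [← hi.2, Fin.insertNth_self_removeNth]
  · intro j _
    simp

lemma h1_eq_sum (Q : Fin n → Measure 𝒳) (a : (Fin (d + 1) → Fin n) → ℝ)
    (h : (Fin (d + 1) → 𝒳) → ℝ) (t : Fin n) (x : 𝒳) :
    h1 Q a h t x = ((n - (d + 1))! : ℝ) / ((n - 1)! : ℝ) *
      ∑ i ∈ distinctTuples n (d + 1), ∑ l, if i l = t then
        a i * (condKernel Q h l (l.removeNth i) x - theta Q h i) else 0 := by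
  unfold h1
  congr 1
  rw [Finset.sum_comm, Finset.sum_comm (s := distinctTuples n (d + 1))]
  refine Finset.sum_congr rfl fun l _ => ?_
  exact sum_distinctTuplesAvoiding l t fun i j => a i * (condKernel Q h l j x - theta Q h i)

lemma inv_mul_factorial_ratio (hn : 0 < n) (k : ℕ) :
    (n : ℝ)⁻¹ * (((n - k)! : ℝ) / ((n - 1)! : ℝ)) = ((n - k)! : ℝ) / (n ! : ℝ) := by
  have h1 : (n ! : ℝ) = n * (n - 1)! := by
    exact_mod_cast (Nat.mul_factorial_pred hn.ne').symm
  have hn' : (n : ℝ) ≠ 0 := by exact_mod_cast hn.ne'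
  rw [h1]
  field_simp

end Reindexing

/-! ### Variance of a U-statistic and of its projection -/

section Variance

variable {Ω 𝒳 : Type*} [MeasurableSpace Ω] [MeasurableSpace 𝒳] {n d : ℕ}
  {P : Measure Ω} [IsProbabilityMeasure P] {X : Fin n → Ω → 𝒳}
  {h : (Fin (d + 1) → 𝒳) → ℝ} {i j : Fin (d + 1) → Fin n}

lemma measurable_kernel_comp (hX : ∀ t, Measurable (X t)) (hh : Measurable h)
    (i : Fin (d + 1) → Fin n) : Measurable fun ω => h (fun l => X (i l) ω) :=
  hh.comp (measurable_pi_lambda _ fun l => hX (i l))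

lemma measurable_condKernel_comp (hX : ∀ t, Measurable (X t)) (hh : Measurable h)
    (l : Fin (d + 1)) (r : Fin d → Fin n) (t : Fin n) :
    Measurable fun ω => condKernel (laws P X) h l r (X t ω) := by
  have := fun i => isProbabilityMeasure_laws (P := P) hX i
  exact (measurable_condKernel _ hh l r).comp (hX t)

lemma lintegral_sq_condKernel_removeNth_le (hX : ∀ t, Measurable (X t)) (hind : iIndepFun X P)
    (hh : Measurable h) (hi : Function.Injective i) (l : Fin (d + 1)) :
    ∫⁻ ω, ENNReal.ofReal (condKernel (laws P X) h l (l.removeNth i) (X (i l) ω) ^ 2) ∂P ≤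
      ∫⁻ ω, ENNReal.ofReal (h (fun k => X (i k) ω) ^ 2) ∂P := by
  have := lintegral_sq_condKernel_le_of_ne hX hind hh l (removeNth_injective (l := l) hi)
    (removeNth_ne hi)
  rwa [Fin.insertNth_self_removeNth] at this

lemma integral_kernel_eq_integral_condKernel (hX : ∀ t, Measurable (X t)) (hind : iIndepFun X P)
    (hh : Measurable h) (hi : Function.Injective i) (l : Fin (d + 1))
    (hint : Integrable (fun ω => h (fun k => X (i k) ω)) P) :
    ∫ ω, h (fun k => X (i k) ω) ∂P
      = ∫ ω, condKernel (laws P X) h l (l.removeNth i) (X (i l) ω) ∂P := by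
  have := integral_kernel_mul_eq hX hind hh l (removeNth_injective (l := l) hi)
    (s := fun _ : Unit => i l) (fun k _ => removeNth_ne hi k) () (g := fun _ => 1)
    measurable_const
  simp only [Fin.insertNth_self_removeNth, mul_one] at this
  exact this hint

/-- Given the single shared variable the two kernels are independent, so each may be replaced by its
conditional mean. -/
lemma covariance_kernel_eq_covariance_condKernel (hX : ∀ t, Measurable (X t))
    (hind : iIndepFun X P) (hh : Measurable h) (hi : Function.Injective i)
    (hj : Function.Injective j) (hLi : MemLp (fun ω => h (fun k => X (i k) ω)) 2 P)
    (hLj : MemLp (fun ω => h (fun k => X (j k) ω)) 2 P) {p q : Fin (d + 1)} (hpq : i p = j q)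
    (huniq : ∀ p' q', i p' = j q' → p' = p ∧ q' = q) :
    cov[fun ω => h (fun k => X (i k) ω), fun ω => h (fun k => X (j k) ω); P]
      = cov[fun ω => condKernel (laws P X) h p (p.removeNth i) (X (i p) ω),
          fun ω => condKernel (laws P X) h q (q.removeNth j) (X (j q) ω); P] := by
  have := fun i => isProbabilityMeasure_laws (P := P) hX i
  have hFi : MemLp (fun ω => condKernel (laws P X) h p (p.removeNth i) (X (i p) ω)) 2 P :=
    memLp_two_of_lintegral_sq_lt_top
      (measurable_condKernel_comp hX hh _ _ _).aestronglyMeasurable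
      ((lintegral_sq_condKernel_removeNth_le hX hind hh hi p).trans_lt
        ((hasFiniteIntegral_iff_ofReal (ae_of_all _ fun x => sq_nonneg _)).1 hLi.integrable_sq.2))
  have hFj : MemLp (fun ω => condKernel (laws P X) h q (q.removeNth j) (X (j q) ω)) 2 P :=
    memLp_two_of_lintegral_sq_lt_top
      (measurable_condKernel_comp hX hh _ _ _).aestronglyMeasurable
      ((lintegral_sq_condKernel_removeNth_le hX hind hh hj q).trans_lt
        ((hasFiniteIntegral_iff_ofReal (ae_of_all _ fun x => sq_nonneg _)).1 hLj.integrable_sq.2))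
  rw [covariance_eq_sub hLi hLj, covariance_eq_sub hFi hFj,
    integral_kernel_eq_integral_condKernel hX hind hh hi p (hLi.integrable (by norm_num)),
    integral_kernel_eq_integral_condKernel hX hind hh hj q (hLj.integrable (by norm_num))]
  congr 1
  simp only [Pi.mul_apply]
  -- The other entries of `i` avoid all of `j`, so they are integrated out with the second kernel
  -- kept; `e2` then integrates the other entries of `j`.
  have e1 := integral_kernel_mul_eq hX hind hh p (removeNth_injective (l := p) hi) (s := j)
    (fun k k' heq => Fin.succAbove_ne p k (huniq _ _ heq).1) q (g := h) hh
  rw [← hpq, Fin.insertNth_self_removeNth] at e1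
  rw [e1 (hLi.integrable_mul hLj)]
  have e2 := integral_kernel_mul_eq hX hind hh q (removeNth_injective (l := q) hj)
    (s := fun _ : Unit => j q) (fun k _ => removeNth_ne hj k) ()
    (g := fun z => condKernel (laws P X) h p (p.removeNth i) (z ()))
    ((measurable_condKernel _ hh _ _).comp (measurable_pi_apply ()))
  rw [Fin.insertNth_self_removeNth, ← hpq] at e2
  simp only [mul_comm] at e2 ⊢
  rw [← hpq]
  exact e2 (hLj.integrable_mul hFi)

lemma covariance_condKernel_eq_zero (hX : ∀ t, Measurable (X t))
    (hind : iIndepFun X P) (hh : Measurable h) {l q : Fin (d + 1)} {r s : Fin d → Fin n}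
    {t u : Fin n} (htu : t ≠ u)
    (h1 : MemLp (fun ω => condKernel (laws P X) h l r (X t ω)) 2 P)
    (h2 : MemLp (fun ω => condKernel (laws P X) h q s (X u ω)) 2 P) :
    cov[fun ω => condKernel (laws P X) h l r (X t ω),
      fun ω => condKernel (laws P X) h q s (X u ω); P] = 0 := by
  have := fun i => isProbabilityMeasure_laws (P := P) hX i
  exact ((hind.indepFun htu).comp (measurable_condKernel _ hh l r)
    (measurable_condKernel _ hh q s)).covariance_eq_zero h1 h2

lemma variance_sum_eq {α : Type*} (s : Finset α) {Y : α → Ω → ℝ}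
    (hY : ∀ b ∈ s, MemLp (Y b) 2 P) :
    Var[fun ω => ∑ b ∈ s, Y b ω; P] = ∑ b ∈ s, ∑ c ∈ s, cov[Y b, Y c; P] := by
  rw [← covariance_self (memLp_finsetSum s hY).aestronglyMeasurable.aemeasurable,
    covariance_fun_sum_fun_sum' hY hY]

/-- The variance of a weighted U-statistic is that of its first order projection, up to the
contribution of pairs of tuples with at least two common indices. -/
theorem abs_variance_uStat_sub_mainVar_le (hX : ∀ t, Measurable (X t)) (hind : iIndepFun X P)
    (hh : Measurable h) (a : (Fin (d + 1) → Fin n) → ℝ) {B : ℝ} (hB : 0 ≤ B)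
    (hhB : ∀ i ∈ distinctTuples n (d + 1),
      ∫⁻ ω, ENNReal.ofReal (h (fun l => X (i l) ω) ^ 2) ∂P ≤ ENNReal.ofReal B) (hn : 0 < n) :
    |Var[fun ω => uStat a h (fun t => X t ω); P] - mainVar P X a h| ≤
      (((n - (d + 1))! : ℝ) / (n ! : ℝ)) ^ 2 *
        ((1 + (d + 1) ^ 2) * B * shareSum a 2) := by
  set I := distinctTuples n (d + 1) with hI
  set c := ((n - (d + 1))! : ℝ) / (n ! : ℝ) with hc
  set H : (Fin (d + 1) → Fin n) → Ω → ℝ := fun i ω => h (fun k => X (i k) ω) with hH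
  set F : (Fin (d + 1) → Fin n) → Fin (d + 1) → Ω → ℝ := fun i l ω =>
    condKernel (laws P X) h l (l.removeNth i) (X (i l) ω) with hF
  have hHL : ∀ i ∈ I, MemLp (H i) 2 P := fun i hi => memLp_two_of_lintegral_sq_lt_top
    (measurable_kernel_comp hX hh i).aestronglyMeasurable
    ((hhB i hi).trans_lt ENNReal.ofReal_lt_top)
  have hHB : ∀ i ∈ I, ∫ ω, H i ω ^ 2 ∂P ≤ B := fun i hi => integral_sq_le_of_lintegral_sq_le
    (measurable_kernel_comp hX hh i).aestronglyMeasurable hB (hhB i hi)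
  have hFb : ∀ i ∈ I, ∀ l, ∫⁻ ω, ENNReal.ofReal (F i l ω ^ 2) ∂P ≤ ENNReal.ofReal B :=
    fun i hi l => (lintegral_sq_condKernel_removeNth_le hX hind hh
      (mem_distinctTuples.1 hi) l).trans (hhB i hi)
  have hFL : ∀ i ∈ I, ∀ l, MemLp (F i l) 2 P := fun i hi l => memLp_two_of_lintegral_sq_lt_top
    (measurable_condKernel_comp hX hh _ _ _).aestronglyMeasurable
    ((hFb i hi l).trans_lt ENNReal.ofReal_lt_top)
  have hFB : ∀ i ∈ I, ∀ l, ∫ ω, F i l ω ^ 2 ∂P ≤ B := fun i hi l =>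
    integral_sq_le_of_lintegral_sq_le
      (measurable_condKernel_comp hX hh _ _ _).aestronglyMeasurable hB (hFb i hi l)
  have hU : Var[fun ω => uStat a h (fun t => X t ω); P]
      = c ^ 2 * ∑ i ∈ I, ∑ j ∈ I, a i * a j * cov[H i, H j; P] := by
    unfold uStat
    rw [variance_const_mul, variance_sum_eq I (Y := fun i ω => a i * H i ω)
      fun i hi => (hHL i hi).const_mul _]
    congr 1
    refine Finset.sum_congr rfl fun i _ => Finset.sum_congr rfl fun j _ => ?_
    rw [covariance_const_mul_left, covariance_const_mul_right, mul_assoc]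
  -- Summing over `t` collapses the indicator `i l = t`: each tuple contributes one term per
  -- position.
  have hlin : ∀ ω, (n : ℝ)⁻¹ * ∑ t, h1 (laws P X) a h t (X t ω)
      = c * ∑ i ∈ I, a i * ∑ l, (F i l ω - theta (laws P X) h i) := by
    intro ω
    simp only [h1_eq_sum]
    rw [← Finset.mul_sum, ← mul_assoc, inv_mul_factorial_ratio hn, Finset.sum_comm]
    congr 1
    refine Finset.sum_congr rfl fun i _ => ?_
    rw [Finset.sum_comm, Finset.mul_sum]
    refine Finset.sum_congr rfl fun l _ => ?_
    rw [Finset.sum_ite_eq]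
    simp [hF]
  have hVL : ∀ i ∈ I, MemLp (fun ω => ∑ l, (F i l ω - theta (laws P X) h i)) 2 P :=
    fun i hi => memLp_finsetSum _ fun l _ => (hFL i hi l).sub (memLp_const _)
  have hV : mainVar P X a h = c ^ 2 * ∑ i ∈ I, ∑ j ∈ I, a i * a j *
      ∑ l, ∑ q, cov[F i l, F j q; P] := by
    unfold mainVar
    simp only [hlin]
    rw [variance_const_mul, variance_sum_eq I
      (Y := fun i ω => a i * ∑ l, (F i l ω - theta (laws P X) h i))
      fun i hi => (hVL i hi).const_mul _]
    congr 1
    refine Finset.sum_congr rfl fun i hi => Finset.sum_congr rfl fun j hj => ?_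
    rw [covariance_const_mul_left, covariance_const_mul_right, mul_assoc]
    congr 2
    rw [covariance_fun_sum_fun_sum (X := fun l ω => F i l ω - theta (laws P X) h i)
      (Y := fun q ω => F j q ω - theta (laws P X) h j) (fun l => (hFL i hi l).sub (memLp_const _))
      (fun q => (hFL j hj q).sub (memLp_const _))]
    refine Finset.sum_congr rfl fun l _ => Finset.sum_congr rfl fun q _ => ?_
    rw [covariance_sub_const_left ((hFL i hi l).integrable (by norm_num)),
      covariance_sub_const_right ((hFL j hj q).integrable (by norm_num))]
  have hsub : Var[fun ω => uStat a h (fun t => X t ω); P] - mainVar P X a h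
      = c ^ 2 * ∑ i ∈ I, ∑ j ∈ I, a i * a j *
        (cov[H i, H j; P] - ∑ l, ∑ q, cov[F i l, F j q; P]) := by
    rw [hU, hV, ← mul_sub, ← Finset.sum_sub_distrib]
    congr 1
    refine Finset.sum_congr rfl fun i _ => ?_
    rw [← Finset.sum_sub_distrib]
    refine Finset.sum_congr rfl fun j _ => ?_
    ring
  rw [hsub, abs_mul, abs_of_nonneg (sq_nonneg c)]
  refine mul_le_mul_of_nonneg_left ?_ (sq_nonneg c)
  have hFz : ∀ i ∈ I, ∀ j ∈ I, ∀ l q, i l ≠ j q → cov[F i l, F j q; P] = 0 :=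
    fun i hi j hj l q hne =>
      covariance_condKernel_eq_zero hX hind hh hne (hFL i hi l) (hFL j hj q)
  -- `B₁ = 0` because the two covariances agree exactly on pairs with one common index. In `B₂`, the
  -- 1 comes from the kernels and (d + 1)² from the pairs of positions.
  have := abs_sum_sum_mul_le a (fun i j => cov[H i, H j; P] - ∑ l, ∑ q, cov[F i l, F j q; P])
    (B₁ := 0) (B₂ := (1 + (d + 1) ^ 2) * B) le_rfl (by positivity) ?_ ?_ ?_
  · simpa using this
  · intro i hi j hj hne
    have h1 : cov[H i, H j; P] = 0 := ((indepFun_subtuple hX hind hne).comp hh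
      hh).covariance_eq_zero (hHL i hi) (hHL j hj)
    rw [h1, zero_sub, neg_eq_zero]
    exact Finset.sum_eq_zero fun l _ => Finset.sum_eq_zero fun q _ => hFz i hi j hj l q (hne l q)
  · intro i hi j hj p q hpq huniq
    have h1 : cov[H i, H j; P] = cov[F i p, F j q; P] :=
      covariance_kernel_eq_covariance_condKernel hX hind hh (mem_distinctTuples.1 hi)
        (mem_distinctTuples.1 hj) (hHL i hi) (hHL j hj) hpq huniq
    have h2 : ∑ l, ∑ q, cov[F i l, F j q; P] = cov[F i p, F j q; P] := by
      rw [Finset.sum_eq_single p, Finset.sum_eq_single q]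
      · exact fun q' _ hne => hFz i hi j hj _ _ fun heq => hne (huniq _ _ heq).2
      · simp
      · exact fun p' _ hne => Finset.sum_eq_zero fun q' _ =>
          hFz i hi j hj _ _ fun heq => hne (huniq _ _ heq).1
      · simp
    rw [h1, h2, sub_self, abs_zero]
  · intro i hi j hj
    have h1 := abs_covariance_le_of_integral_sq_le (hHL i hi) (hHL j hj) (hHB i hi) (hHB j hj)
    have h2 : |∑ l, ∑ q, cov[F i l, F j q; P]| ≤ (d + 1) ^ 2 * B := by
      refine (Finset.abs_sum_le_sum_abs _ _).trans ?_
      refine (Finset.sum_le_card_nsmul _ _ ((d + 1) * B) fun l _ => ?_).trans (le_of_eq ?_)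
      · refine (Finset.abs_sum_le_sum_abs _ _).trans ?_
        refine (Finset.sum_le_card_nsmul _ _ B fun q _ => ?_).trans (le_of_eq ?_)
        · exact abs_covariance_le_of_integral_sq_le (hFL i hi l) (hFL j hj q) (hFB i hi l)
            (hFB j hj q)
        · simp
      · simp
        ring
    refine (abs_sub _ _).trans ?_
    linarith

end Variance

/-! ### The empirical distribution and the bootstrap law -/

section Empirical

variable {𝒳 : Type*} [MeasurableSpace 𝒳] {n d : ℕ}

lemma isProbabilityMeasure_empirical (hn : 0 < n) (x : Fin n → 𝒳) :
    IsProbabilityMeasure (empirical x) := by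
  constructor
  simp only [empirical, Measure.smul_apply, Measure.coe_finsetSum, Finset.sum_apply,
    measure_univ, Finset.sum_const, Finset.card_univ, Fintype.card_fin, nsmul_eq_mul, mul_one,
    smul_eq_mul]
  exact ENNReal.inv_mul_cancel (by exact_mod_cast hn.ne') (ENNReal.natCast_ne_top n)

/-- Singletons of `𝒳` need not be measurable. Pulling back to the uniform law on `Fin n`, where
every function is measurable and integrable, makes all integrals finite sums. -/
lemma empirical_eq_map (x : Fin n → 𝒳) :
    empirical x = (empirical (id : Fin n → Fin n)).map x := by
  have hx : Measurable x := measurable_of_finite x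
  ext s hs
  rw [Measure.map_apply hx hs]
  simp only [empirical, Measure.smul_apply, Measure.coe_finsetSum, Finset.sum_apply, smul_eq_mul,
    Measure.dirac_apply' _ hs, Measure.dirac_apply' _ (hx hs), id]
  rfl

lemma empirical_id_singleton (j : Fin n) :
    empirical (id : Fin n → Fin n) {j} = (n : ℝ≥0∞)⁻¹ := by
  simp [empirical, Set.indicator_apply]

lemma pi_empirical_id_singleton (hn : 0 < n) {k : ℕ} (r : Fin k → Fin n) :
    (Measure.pi fun _ : Fin k => empirical (id : Fin n → Fin n)) {r} = ((n : ℝ≥0∞) ^ k)⁻¹ := by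
  have := isProbabilityMeasure_empirical hn (id : Fin n → Fin n)
  rw [Measure.pi_singleton]
  simp [empirical_id_singleton, ENNReal.inv_pow]

lemma pi_empirical_eq_map (hn : 0 < n) (k : ℕ) (x : Fin n → 𝒳) :
    (Measure.pi fun _ : Fin k => empirical x)
      = (Measure.pi fun _ : Fin k => empirical (id : Fin n → Fin n)).map
        fun r l => x (r l) := by
  have := isProbabilityMeasure_empirical hn (id : Fin n → Fin n)
  have h2 := isProbabilityMeasure_empirical hn x
  rw [empirical_eq_map x] at h2 ⊢
  exact (Measure.pi_map_pi fun _ => (measurable_of_finite x).aemeasurable).symm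

lemma lintegral_pi_empirical (hn : 0 < n) {k : ℕ} (x : Fin n → 𝒳) {g : (Fin k → 𝒳) → ℝ≥0∞}
    (hg : Measurable g) :
    ∫⁻ y, g y ∂(Measure.pi fun _ : Fin k => empirical x)
      = ((n : ℝ≥0∞) ^ k)⁻¹ * ∑ r : Fin k → Fin n, g (fun l => x (r l)) := by
  rw [pi_empirical_eq_map hn, lintegral_map hg (measurable_of_finite _), lintegral_fintype,
    Finset.mul_sum]
  refine Finset.sum_congr rfl fun r _ => ?_
  rw [pi_empirical_id_singleton hn, mul_comm]

lemma integral_pi_empirical (hn : 0 < n) {k : ℕ} (x : Fin n → 𝒳) {g : (Fin k → 𝒳) → ℝ}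
    (hg : Measurable g) :
    ∫ y, g y ∂(Measure.pi fun _ : Fin k => empirical x)
      = ((n : ℝ) ^ k)⁻¹ * ∑ r : Fin k → Fin n, g (fun l => x (r l)) := by
  have := isProbabilityMeasure_empirical hn (id : Fin n → Fin n)
  rw [pi_empirical_eq_map hn, integral_map (measurable_of_finite _).aemeasurable
    hg.aestronglyMeasurable, integral_fintype (Integrable.of_finite), Finset.mul_sum]
  refine Finset.sum_congr rfl fun r _ => ?_
  rw [measureReal_def, pi_empirical_id_singleton hn, smul_eq_mul]
  simp

lemma integral_empirical (hn : 0 < n) (x : Fin n → 𝒳) {g : 𝒳 → ℝ} (hg : Measurable g) :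
    ∫ y, g y ∂(empirical x) = (n : ℝ)⁻¹ * ∑ j, g (x j) := by
  have := isProbabilityMeasure_empirical hn (id : Fin n → Fin n)
  rw [empirical_eq_map, integral_map (measurable_of_finite _).aemeasurable
    hg.aestronglyMeasurable, integral_fintype (Integrable.of_finite), Finset.mul_sum]
  refine Finset.sum_congr rfl fun r _ => ?_
  rw [measureReal_def, empirical_id_singleton, smul_eq_mul]
  simp

lemma memLp_two_empirical (hn : 0 < n) (x : Fin n → 𝒳) {g : 𝒳 → ℝ} (hg : Measurable g) :
    MemLp g 2 (empirical x) := by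
  have := isProbabilityMeasure_empirical hn (id : Fin n → Fin n)
  rw [memLp_two_iff_integrable_sq hg.aestronglyMeasurable, empirical_eq_map,
    integrable_map_measure (hg.pow_const 2).aestronglyMeasurable
      (measurable_of_finite _).aemeasurable]
  exact Integrable.of_finite

lemma variance_empirical (hn : 0 < n) (x : Fin n → 𝒳) {g : 𝒳 → ℝ} (hg : Measurable g) :
    Var[g; empirical x]
      = (n : ℝ)⁻¹ * ∑ j, g (x j) ^ 2 - ((n : ℝ)⁻¹ * ∑ j, g (x j)) ^ 2 := by
  have := isProbabilityMeasure_empirical hn x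
  rw [variance_eq_sub (memLp_two_empirical hn x hg), integral_empirical hn x hg]
  congr 1
  exact integral_empirical hn x (hg.pow_const 2)

lemma condKernel_empirical (hn : 0 < n) (x : Fin n → 𝒳) {h : (Fin (d + 1) → 𝒳) → ℝ}
    (hh : Measurable h) (l : Fin (d + 1)) (j : Fin d → Fin n) (y : 𝒳) :
    condKernel (fun _ : Fin n => empirical x) h l j y
      = ((n : ℝ) ^ d)⁻¹ * ∑ r : Fin d → Fin n, h (l.insertNth y (fun k => x (r k))) :=
  integral_pi_empirical hn x (hh.comp (measurable_insertNth l measurable_const measurable_id))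

lemma laws_bootstrapLaw (hn : 0 < n) (x : Fin n → 𝒳) :
    laws (bootstrapLaw x) (fun t (y : Fin n → 𝒳) => y t) = fun _ => empirical x := by
  have := isProbabilityMeasure_empirical hn x
  ext1 t
  exact (measurePreserving_eval (fun _ : Fin n => empirical x) t).map_eq

lemma mainVar_bootstrapLaw (hn : 0 < n) (x : Fin n → 𝒳) (a : (Fin (d + 1) → Fin n) → ℝ)
    {h : (Fin (d + 1) → 𝒳) → ℝ} (hh : Measurable h) :
    mainVar (bootstrapLaw x) (fun t (y : Fin n → 𝒳) => y t) a h
      = ((n : ℝ)⁻¹) ^ 2 * ∑ t, Var[h1 (fun _ => empirical x) a h t; empirical x] := by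
  have := isProbabilityMeasure_empirical hn x
  have hm := fun t => measurable_h1 (fun _ : Fin n => empirical x) a hh t
  have hL : ∀ t : Fin n, MemLp (fun y : Fin n → 𝒳 => h1 (fun _ => empirical x) a h t (y t)) 2
      (bootstrapLaw x) := fun t =>
    (memLp_two_empirical hn x (hm t)).comp_measurePreserving
      (measurePreserving_eval (fun _ : Fin n => empirical x) t)
  unfold mainVar
  rw [variance_const_mul, laws_bootstrapLaw hn]
  congr 1
  have hind : iIndepFun (fun t (y : Fin n → 𝒳) => h1 (fun _ => empirical x) a h t (y t))
      (bootstrapLaw x) := iIndepFun_pi fun t => (hm t).aemeasurable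
  have hs := IndepFun.variance_sum (s := Finset.univ) (fun t _ => hL t)
    (fun t _ u _ htu => hind.indepFun htu)
  have e : (fun y : Fin n → 𝒳 => ∑ t, h1 (fun _ => empirical x) a h t (y t))
      = ∑ t, fun y : Fin n → 𝒳 => h1 (fun _ => empirical x) a h t (y t) := by
    ext y
    simp
  rw [e, hs]
  refine Finset.sum_congr rfl fun t _ => ?_
  have hmap := (measurePreserving_eval (fun _ : Fin n => empirical x) t).map_eq
  rw [← congrArg (fun ν => Var[h1 (fun _ => empirical x) a h t; ν]) hmap,
    variance_map (hm t).aemeasurable (measurable_pi_apply t).aemeasurable]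
  rfl

/-- The average of the squared kernel over all index tuples, repetitions included. -/
def meanSqKernel {k : ℕ} (h : (Fin k → 𝒳) → ℝ) (x : Fin n → 𝒳) : ℝ :=
  ((n : ℝ) ^ k)⁻¹ * ∑ r : Fin k → Fin n, h (fun l => x (r l)) ^ 2

lemma meanSqKernel_nonneg {𝒴 : Type*} {k : ℕ} (h : (Fin k → 𝒴) → ℝ) (x : Fin n → 𝒴) :
    0 ≤ meanSqKernel h x :=
  mul_nonneg (by positivity) (Finset.sum_nonneg fun _ _ => sq_nonneg _)

/-- The bootstrap variance is that of the first order projection under the empirical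
distribution, up to the contribution of pairs of tuples with two common indices. -/
lemma abs_variance_bootstrap_sub_le (hn : 0 < n) (x : Fin n → 𝒳)
    (a : (Fin (d + 1) → Fin n) → ℝ) {h : (Fin (d + 1) → 𝒳) → ℝ} (hh : Measurable h) :
    |Var[uStat a h; bootstrapLaw x]
        - ((n : ℝ)⁻¹) ^ 2 * ∑ t, Var[h1 (fun _ => empirical x) a h t; empirical x]|
      ≤ (((n - (d + 1))! : ℝ) / (n ! : ℝ)) ^ 2 *
        ((1 + (d + 1) ^ 2) * meanSqKernel h x * shareSum a 2) := by
  have := isProbabilityMeasure_empirical hn x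
  have : IsProbabilityMeasure (bootstrapLaw x) := by
    unfold bootstrapLaw; infer_instance
  have hmeas : ∀ t : Fin n, Measurable fun y : Fin n → 𝒳 => y t := fun t => measurable_pi_apply t
  have hind : iIndepFun (fun t (y : Fin n → 𝒳) => y t) (bootstrapLaw x) :=
    iIndepFun_pi (X := fun _ z => z) fun t => aemeasurable_id
  rw [← mainVar_bootstrapLaw hn x a hh]
  -- Distinct positions of the bootstrap sample have law P̂^(d+1) whichever they are, so one bound,
  -- the average over all index tuples, serves every `i`.
  refine abs_variance_uStat_sub_mainVar_le hmeas hind hh a (meanSqKernel_nonneg h x) ?_ hn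
  intro i hi
  have hmap := map_subtuple hmeas hind (mem_distinctTuples.1 hi)
  rw [laws_bootstrapLaw hn] at hmap
  have hsq : Measurable fun z => ENNReal.ofReal (h z ^ 2) := (hh.pow_const 2).ennreal_ofReal
  rw [← lintegral_map (μ := bootstrapLaw x) (g := fun y l => y (i l)) hsq
    (measurable_pi_lambda _ fun l => hmeas (i l)), hmap, lintegral_pi_empirical hn x hsq,
    meanSqKernel, ENNReal.ofReal_mul (by positivity),
    ENNReal.ofReal_sum_of_nonneg fun _ _ => sq_nonneg _,
    ENNReal.ofReal_inv_of_pos (by positivity), ENNReal.ofReal_pow (by positivity),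
    ENNReal.ofReal_natCast]

end Empirical

/-! ### Deviations of the kernel from its projection -/

section CrossMoments

variable {Ω 𝒳 : Type*} [MeasurableSpace Ω] [MeasurableSpace 𝒳] {n d : ℕ}
  {P : Measure Ω} {X : Fin n → Ω → 𝒳}

lemma crossGap_nonneg {m : ℕ} (h : (Fin m → 𝒳) → ℝ) : 0 ≤ crossGap P X h := by
  refine Real.sSup_nonneg ?_
  rintro v ⟨p, q, r, -, s, -, k, -, -, -, -, -, rfl⟩
  exact abs_nonneg _

lemma abs_crossMoment_sub_le_crossGap {m : ℕ} (h : (Fin m → 𝒳) → ℝ) {p q : Fin m}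
    {r s k : Fin m → Fin n} (hr : Function.Injective r) (hs : Function.Injective s)
    (hk : Function.Injective k) (hrs : Set.range r ∩ Set.range s = {r p}) (hrp : r p = s q)
    (hks : Set.range k ∩ Set.range s = {k p}) (hkp : k p = s q) :
    |crossMoment P X h r s (k p) - crossMoment P X h k s (k p)| ≤ crossGap P X h := by
  -- The values come from a finite family, so the supremum is a genuine one.
  refine le_csSup (Set.Finite.bddAbove ?_) ⟨p, q, r, mem_distinctTuples.2 hr, s,
    mem_distinctTuples.2 hs, k, mem_distinctTuples.2 hk, hrs, hrp, hks, hkp, rfl⟩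
  refine (Set.finite_range fun z : Fin m × (Fin m → Fin n) × (Fin m → Fin n) × (Fin m → Fin n) =>
    |crossMoment P X h z.2.1 z.2.2.1 (z.2.2.2 z.1)
      - crossMoment P X h z.2.2.2 z.2.2.1 (z.2.2.2 z.1)|).subset ?_
  rintro v ⟨p, q, r, -, s, -, k, -, -, -, -, -, rfl⟩
  exact ⟨(p, r, s, k), rfl⟩

lemma range_insertNth_inter {α : Type*} {l q : Fin (d + 1)} {t : α} {r s : Fin d → α}
    (hrs : ∀ k k', r k ≠ s k') (hr : ∀ k, r k ≠ t) :
    Set.range (l.insertNth t r : Fin (d + 1) → α) ∩ Set.range (q.insertNth t s : Fin (d + 1) → α)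
      = {t} := by
  ext v
  rw [Set.mem_inter_iff, Set.mem_range, Set.mem_range, Set.mem_singleton_iff,
    Fin.exists_iff_succAbove l, Fin.exists_iff_succAbove q]
  simp only [Fin.insertNth_apply_same, Fin.insertNth_apply_succAbove]
  constructor
  · rintro ⟨rfl | ⟨k, rfl⟩, h2 | ⟨k', h2⟩⟩
    · rfl
    · rfl
    · exact h2.symm
    · exact (hrs k k' h2.symm).elim
  · rintro rfl
    exact ⟨Or.inl rfl, Or.inl rfl⟩

variable [IsProbabilityMeasure P]

/-- Tower property; in particular the conditioning index `c` is immaterial. -/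
lemma crossMoment_eq (hX : ∀ t, Measurable (X t)) {m : ℕ} (h : (Fin m → 𝒳) → ℝ)
    (r s : Fin m → Fin n) (c : Fin n) :
    crossMoment P X h r s c = ∫ ω, h (fun l => X (r l) ω) * h (fun l => X (s l) ω) ∂P :=
  integral_condExp (hX c).comap_le

/-- The kernel at `X_τ` in position `l` and `X_r` elsewhere, minus its projection with the other
arguments integrated against the laws of `X_s`. -/
def kernelDev (P : Measure Ω) (X : Fin n → Ω → 𝒳) (h : (Fin (d + 1) → 𝒳) → ℝ) (l : Fin (d + 1))
    (s : Fin d → Fin n) (τ : Fin n) (r : Fin d → Fin n) (ω : Ω) : ℝ :=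
  h (fun k => X ((l.insertNth τ r : Fin (d + 1) → Fin n) k) ω)
    - condKernel (laws P X) h l s (X τ ω)

variable {h : (Fin (d + 1) → 𝒳) → ℝ}

lemma kernelDev_bound (hX : ∀ t, Measurable (X t)) (hh : Measurable h) {l : Fin (d + 1)}
    {s r : Fin d → Fin n} {τ : Fin n} {C : ℝ} (hC : 0 ≤ C)
    (hk : ∫⁻ ω, ENNReal.ofReal (h (fun k => X ((l.insertNth τ r : Fin (d + 1) → Fin n) k) ω) ^ 2) ∂P
      ≤ ENNReal.ofReal C)
    (hc : ∫⁻ ω, ENNReal.ofReal (condKernel (laws P X) h l s (X τ ω) ^ 2) ∂P ≤ ENNReal.ofReal C) :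
    MemLp (kernelDev P X h l s τ r) 2 P ∧ ∫ ω, kernelDev P X h l s τ r ω ^ 2 ∂P ≤ 4 * C := by
  have m1 := (measurable_kernel_comp hX hh
    (l.insertNth τ r : Fin (d + 1) → Fin n)).aestronglyMeasurable (μ := P)
  have m2 := (measurable_condKernel_comp (P := P) hX hh l s τ).aestronglyMeasurable (μ := P)
  have L1 := memLp_two_of_lintegral_sq_lt_top m1 (hk.trans_lt ENNReal.ofReal_lt_top)
  have L2 := memLp_two_of_lintegral_sq_lt_top m2 (hc.trans_lt ENNReal.ofReal_lt_top)
  have b1 := integral_sq_le_of_lintegral_sq_le m1 hC hk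
  have b2 := integral_sq_le_of_lintegral_sq_le m2 hC hc
  have L := L1.sub L2
  refine ⟨L, ?_⟩
  have h3 : ∫ ω, kernelDev P X h l s τ r ω ^ 2 ∂P ≤
      ∫ ω, (2 * h (fun k => X ((l.insertNth τ r : Fin (d + 1) → Fin n) k) ω) ^ 2
        + 2 * condKernel (laws P X) h l s (X τ ω) ^ 2) ∂P := by
    refine integral_mono L.integrable_sq
      ((L1.integrable_sq.const_mul 2).add (L2.integrable_sq.const_mul 2)) fun ω => ?_
    simp only [kernelDev]
    nlinarith [sq_nonneg (h (fun k => X ((l.insertNth τ r : Fin (d + 1) → Fin n) k) ω)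
      + condKernel (laws P X) h l s (X τ ω))]
  rw [integral_add (L1.integrable_sq.const_mul 2) (L2.integrable_sq.const_mul 2),
    integral_const_mul, integral_const_mul] at h3
  linarith

lemma abs_integral_kernel_mul_sub_le_crossGap (hX : ∀ t, Measurable (X t)) (l q : Fin (d + 1)) {s r u : Fin d → Fin n}
    (hs : Function.Injective s) (hr : Function.Injective r) (hu : Function.Injective u)
    {τ : Fin n} (hsτ : ∀ k, s k ≠ τ) (hrτ : ∀ k, r k ≠ τ) (huτ : ∀ k, u k ≠ τ)
    (hru : ∀ k k', r k ≠ u k') (hsu : ∀ k k', s k ≠ u k') :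
    |∫ ω, h (fun k => X ((l.insertNth τ r : Fin (d + 1) → Fin n) k) ω)
        * h (fun k => X ((q.insertNth τ u : Fin (d + 1) → Fin n) k) ω) ∂P
      - ∫ ω, h (fun k => X ((l.insertNth τ s : Fin (d + 1) → Fin n) k) ω)
        * h (fun k => X ((q.insertNth τ u : Fin (d + 1) → Fin n) k) ω) ∂P| ≤ crossGap P X h := by
  rw [← crossMoment_eq hX h _ _ ((l.insertNth τ s : Fin (d + 1) → Fin n) l),
    ← crossMoment_eq hX h _ _ ((l.insertNth τ s : Fin (d + 1) → Fin n) l)]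
  refine abs_crossMoment_sub_le_crossGap h (p := l) (q := q) (insertNth_injective hr hrτ)
    (insertNth_injective hu huτ) (insertNth_injective hs hsτ) ?_ (by simp) ?_ (by simp)
  · rw [Fin.insertNth_apply_same]
    exact range_insertNth_inter hru hrτ
  · rw [Fin.insertNth_apply_same]
    exact range_insertNth_inter hsu hsτ

lemma memLp_condKernel_of_ne (hX : ∀ t, Measurable (X t))
    (hind : iIndepFun X P) (hh : Measurable h)
    (hL : ∀ i : Fin (d + 1) → Fin n, MemLp (fun ω => h (fun k => X (i k) ω)) 2 P)
    (l : Fin (d + 1)) {s : Fin d → Fin n} (hs : Function.Injective s)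
    {τ : Fin n} (hτ : ∀ k, s k ≠ τ) :
    MemLp (fun ω => condKernel (laws P X) h l s (X τ ω)) 2 P := by
  refine memLp_two_of_lintegral_sq_lt_top
    (measurable_condKernel_comp hX hh l s τ).aestronglyMeasurable
    ((lintegral_sq_condKernel_le_of_ne hX hind hh l hs hτ).trans_lt ?_)
  exact (hasFiniteIntegral_iff_ofReal (ae_of_all _ fun x => sq_nonneg _)).1
    (hL _).integrable_sq.2

/-- The entries of `s` avoid both `τ` and `r`, so the projection is the conditional mean of the
first kernel given all variables of the second. -/
lemma integral_condKernel_mul_kernel (hX : ∀ t, Measurable (X t))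
    (hind : iIndepFun X P) (hh : Measurable h)
    (hL : ∀ i : Fin (d + 1) → Fin n, MemLp (fun ω => h (fun k => X (i k) ω)) 2 P)
    (l q : Fin (d + 1)) {s r : Fin d → Fin n}
    (hs : Function.Injective s) {τ : Fin n} (hsτ : ∀ k, s k ≠ τ) (hsr : ∀ k k', s k ≠ r k') :
    ∫ ω, condKernel (laws P X) h l s (X τ ω)
        * h (fun k => X ((q.insertNth τ r : Fin (d + 1) → Fin n) k) ω) ∂P
      = ∫ ω, h (fun k => X ((l.insertNth τ s : Fin (d + 1) → Fin n) k) ω)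
        * h (fun k => X ((q.insertNth τ r : Fin (d + 1) → Fin n) k) ω) ∂P := by
  have hdisj : ∀ k k', s k ≠ (q.insertNth τ r : Fin (d + 1) → Fin n) k' := by
    intro k k'
    refine Fin.succAboveCases q ?_ (fun k' => ?_) k'
    · simpa using hsτ k
    · simpa using hsr k k'
  have := integral_kernel_mul_eq hX hind hh l hs hdisj q (g := h) hh
  rw [Fin.insertNth_apply_same] at this
  exact (this ((hL _).integrable_mul (hL _))).symm

lemma integral_condKernel_mul_condKernel (hX : ∀ t, Measurable (X t))
    (hind : iIndepFun X P) (hh : Measurable h)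
    (hL : ∀ i : Fin (d + 1) → Fin n, MemLp (fun ω => h (fun k => X (i k) ω)) 2 P)
    (l q : Fin (d + 1)) {s r : Fin d → Fin n}
    (hs : Function.Injective s) (hr : Function.Injective r) {τ : Fin n} (hsτ : ∀ k, s k ≠ τ)
    (hrτ : ∀ k, r k ≠ τ) (hsr : ∀ k k', s k ≠ r k') :
    ∫ ω, condKernel (laws P X) h l s (X τ ω) * condKernel (laws P X) h q r (X τ ω) ∂P
      = ∫ ω, h (fun k => X ((l.insertNth τ s : Fin (d + 1) → Fin n) k) ω)
        * h (fun k => X ((q.insertNth τ r : Fin (d + 1) → Fin n) k) ω) ∂P := by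
  have := fun i => isProbabilityMeasure_laws (P := P) hX i
  rw [← integral_condKernel_mul_kernel hX hind hh hL l q hs hsτ hsr]
  have e2 := integral_kernel_mul_eq hX hind hh q hr
    (s := fun _ : Unit => τ) (fun k _ => hrτ k) ()
    (g := fun z => condKernel (laws P X) h l s (z ()))
    ((measurable_condKernel _ hh _ _).comp (measurable_pi_apply ()))
    ((hL _).integrable_mul (memLp_condKernel_of_ne hX hind hh hL l hs hsτ))
  simp only [mul_comm] at e2 ⊢
  rw [e2]

/-- In general position the deviations are correlated only through the heterogeneity. -/
lemma abs_integral_kernelDev_mul_le_crossGap (hX : ∀ t, Measurable (X t))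
    (hind : iIndepFun X P) (hh : Measurable h)
    (hL : ∀ i : Fin (d + 1) → Fin n, MemLp (fun ω => h (fun k => X (i k) ω)) 2 P)
    (l q : Fin (d + 1)) {s s' r r' : Fin d → Fin n}
    (hs : Function.Injective s) (hs' : Function.Injective s') (hr : Function.Injective r)
    (hr' : Function.Injective r') {τ : Fin n} (hsτ : ∀ k, s k ≠ τ) (hsτ' : ∀ k, s' k ≠ τ)
    (hrτ : ∀ k, r k ≠ τ) (hrτ' : ∀ k, r' k ≠ τ) (hrr : ∀ k k', r k ≠ r' k')
    (hss : ∀ k k', s k ≠ s' k') (hsr : ∀ k k', s k ≠ r' k') (hrs : ∀ k k', r k ≠ s' k') :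
    |∫ ω, kernelDev P X h l s τ r ω * kernelDev P X h q s' τ r' ω ∂P| ≤ 2 * crossGap P X h := by
  have L1 := hL (l.insertNth τ r)
  have L2 := hL (q.insertNth τ r')
  have F1 := memLp_condKernel_of_ne hX hind hh hL l hs hsτ
  have F2 := memLp_condKernel_of_ne hX hind hh hL q hs' hsτ'
  -- Expand the product and write each projection as a kernel with fresh arguments. The four cross
  -- moments pair into two differences, each changing only the arguments `r` to `s` of the first
  -- kernel.
  have e : ∫ ω, kernelDev P X h l s τ r ω * kernelDev P X h q s' τ r' ω ∂P
      = ((∫ ω, h (fun k => X ((l.insertNth τ r : Fin (d + 1) → Fin n) k) ω)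
          * h (fun k => X ((q.insertNth τ r' : Fin (d + 1) → Fin n) k) ω) ∂P)
        - ∫ ω, h (fun k => X ((l.insertNth τ s : Fin (d + 1) → Fin n) k) ω)
          * h (fun k => X ((q.insertNth τ r' : Fin (d + 1) → Fin n) k) ω) ∂P)
        - ((∫ ω, h (fun k => X ((l.insertNth τ r : Fin (d + 1) → Fin n) k) ω)
          * h (fun k => X ((q.insertNth τ s' : Fin (d + 1) → Fin n) k) ω) ∂P)
        - ∫ ω, h (fun k => X ((l.insertNth τ s : Fin (d + 1) → Fin n) k) ω)
          * h (fun k => X ((q.insertNth τ s' : Fin (d + 1) → Fin n) k) ω) ∂P) := by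
    have e3 := integral_condKernel_mul_kernel hX hind hh hL q l hs' hsτ'
      (fun k k' => (hrs k' k).symm)
    simp only [mul_comm] at e3
    rw [← integral_condKernel_mul_kernel hX hind hh hL l q hs hsτ hsr,
      ← integral_condKernel_mul_condKernel hX hind hh hL l q hs hs' hsτ hsτ' hss, ← e3]
    have I1 : Integrable (fun ω => h (fun k => X ((l.insertNth τ r : Fin (d + 1) → Fin n) k) ω)
          * h (fun k => X ((q.insertNth τ r' : Fin (d + 1) → Fin n) k) ω)) P :=
      L1.integrable_mul L2
    have I2 : Integrable (fun ω => condKernel (laws P X) h l s (X τ ω)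
          * h (fun k => X ((q.insertNth τ r' : Fin (d + 1) → Fin n) k) ω)) P :=
      F1.integrable_mul L2
    have I3 : Integrable (fun ω => condKernel (laws P X) h q s' (X τ ω)
          * h (fun k => X ((l.insertNth τ r : Fin (d + 1) → Fin n) k) ω)) P :=
      F2.integrable_mul L1
    have I4 : Integrable (fun ω => condKernel (laws P X) h l s (X τ ω)
          * condKernel (laws P X) h q s' (X τ ω)) P :=
      F1.integrable_mul F2
    rw [← integral_sub I1 I2, ← integral_sub I3 I4]
    refine Eq.trans (integral_congr_ae (ae_of_all _ fun ω => ?_))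
      (integral_sub (I1.sub I2) (I3.sub I4))
    simp only [kernelDev]
    ring
  rw [e]
  have g1 := abs_integral_kernel_mul_sub_le_crossGap (h := h) (P := P) hX l q hs hr hr' hsτ hrτ hrτ'
    hrr hsr
  have g2 := abs_integral_kernel_mul_sub_le_crossGap (h := h) (P := P) hX l q hs hr hs' hsτ hrτ hsτ'
    hrs hss
  refine (abs_sub _ _).trans ?_
  linarith

end CrossMoments

/-! ### From the expansion under the empirical law to that under the true laws -/

section ProjectionGap

variable {𝒳 : Type*} [MeasurableSpace 𝒳] {n d : ℕ}

/-- The difference, up to a constant, of the first order expansions under the empirical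
distribution of `x` and under `Q`. -/
def projDiff (Q : Fin n → Measure 𝒳) (a : (Fin (d + 1) → Fin n) → ℝ) (h : (Fin (d + 1) → 𝒳) → ℝ)
    (x : Fin n → 𝒳) (t : Fin n) (y : 𝒳) : ℝ :=
  ((n - (d + 1))! : ℝ) / ((n - 1)! : ℝ) *
    ∑ i ∈ distinctTuples n (d + 1), ∑ l, if i l = t then
      a i * (condKernel (fun _ : Fin n => empirical x) h l (l.removeNth i) y
        - condKernel Q h l (l.removeNth i) y) else 0

/-- The mean square difference of the first order expansions under the empirical distribution of
`x` and under `Q`. -/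
def projGap (Q : Fin n → Measure 𝒳) (a : (Fin (d + 1) → Fin n) → ℝ) (h : (Fin (d + 1) → 𝒳) → ℝ)
    (x : Fin n → 𝒳) : ℝ :=
  ((n : ℝ)⁻¹) ^ 2 * ∑ t, (n : ℝ)⁻¹ * ∑ τ, projDiff Q a h x t (x τ) ^ 2

lemma projGap_nonneg (Q : Fin n → Measure 𝒳) (a : (Fin (d + 1) → Fin n) → ℝ)
    (h : (Fin (d + 1) → 𝒳) → ℝ) (x : Fin n → 𝒳) : 0 ≤ projGap Q a h x :=
  mul_nonneg (by positivity) (Finset.sum_nonneg fun _ _ => mul_nonneg (by positivity)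
    (Finset.sum_nonneg fun _ _ => sq_nonneg _))

/-- In the expanded square, the sum over `t` retains only positions with `i l = j q`; hence only
pairs of tuples with a common index matter. -/
lemma sum_sum_sq_indicator {m : ℕ} (I : Finset (Fin m → Fin n)) (a : (Fin m → Fin n) → ℝ)
    (D : (Fin m → Fin n) → Fin m → Fin n → ℝ) :
    ∑ t : Fin n, ∑ τ, (∑ i ∈ I, ∑ l, if i l = t then a i * D i l τ else 0) ^ 2
      = ∑ i ∈ I, ∑ j ∈ I, a i * a j *
        ∑ l, ∑ q, if i l = j q then ∑ τ, D i l τ * D j q τ else 0 := by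
  simp only [sq, Finset.sum_mul_sum]
  rw [← Fintype.sum_prod_type' (f := fun t τ => ∑ i ∈ I, ∑ j ∈ I, ∑ l, ∑ q,
    (if i l = t then a i * D i l τ else 0) * (if j q = t then a j * D j q τ else 0))]
  rw [Finset.sum_comm]
  refine Finset.sum_congr rfl fun i _ => ?_
  rw [Finset.sum_comm]
  refine Finset.sum_congr rfl fun j _ => ?_
  rw [Finset.sum_comm, Finset.mul_sum]
  refine Finset.sum_congr rfl fun l _ => ?_
  rw [Finset.sum_comm, Finset.mul_sum]
  refine Finset.sum_congr rfl fun q _ => ?_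
  rw [Fintype.sum_prod_type, Finset.sum_eq_single (i l)]
  · by_cases hlq : i l = j q
    · simp only [hlq, if_true, Finset.mul_sum]
      exact Finset.sum_congr rfl fun τ _ => by ring
    · simp [hlq, Ne.symm hlq]
  · intro t _ ht
    simp [Ne.symm ht]
  · simp

lemma projGap_eq (hn : 0 < n) (Q : Fin n → Measure 𝒳) (a : (Fin (d + 1) → Fin n) → ℝ)
    (h : (Fin (d + 1) → 𝒳) → ℝ) (x : Fin n → 𝒳) :
    projGap Q a h x = (((n - (d + 1))! : ℝ) / (n ! : ℝ)) ^ 2 *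
      ∑ i ∈ distinctTuples n (d + 1), ∑ j ∈ distinctTuples n (d + 1), a i * a j *
        ∑ l, ∑ q, if i l = j q then (n : ℝ)⁻¹ * ∑ τ,
          (condKernel (fun _ : Fin n => empirical x) h l (l.removeNth i) (x τ)
            - condKernel Q h l (l.removeNth i) (x τ)) *
          (condKernel (fun _ : Fin n => empirical x) h q (q.removeNth j) (x τ)
            - condKernel Q h q (q.removeNth j) (x τ)) else 0 := by
  have key := sum_sum_sq_indicator (distinctTuples n (d + 1)) a fun i l τ =>
    condKernel (fun _ : Fin n => empirical x) h l (l.removeNth i) (x τ)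
            - condKernel Q h l (l.removeNth i) (x τ)
  have hL : projGap Q a h x = ((n : ℝ)⁻¹ * (((n - (d + 1))! : ℝ) / ((n - 1)! : ℝ))) ^ 2 *
      ((n : ℝ)⁻¹ * ∑ t, ∑ τ, (∑ i ∈ distinctTuples n (d + 1), ∑ l, if i l = t then
        a i * (condKernel (fun _ : Fin n => empirical x) h l (l.removeNth i) (x τ)
          - condKernel Q h l (l.removeNth i) (x τ)) else 0) ^ 2) := by
    simp only [projGap, projDiff, mul_pow, ← Finset.mul_sum]
    ring
  rw [hL, inv_mul_factorial_ratio hn, key]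
  congr 1
  rw [Finset.mul_sum]
  refine Finset.sum_congr rfl fun i _ => ?_
  rw [Finset.mul_sum]
  refine Finset.sum_congr rfl fun j _ => ?_
  rw [mul_left_comm, Finset.mul_sum]
  congr 1
  refine Finset.sum_congr rfl fun l _ => ?_
  rw [Finset.mul_sum]
  refine Finset.sum_congr rfl fun q _ => ?_
  split_ifs <;> simp

/-- Passing from the expansion under `Q` to the one under the empirical distribution changes the
variance under the empirical distribution by at most the projection gap. -/
lemma abs_sum_variance_sub_le_projGap (hn : 0 < n) (Q : Fin n → Measure 𝒳)
    [∀ i, IsProbabilityMeasure (Q i)] (a : (Fin (d + 1) → Fin n) → ℝ)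
    {h : (Fin (d + 1) → 𝒳) → ℝ} (hh : Measurable h) (x : Fin n → 𝒳) {η : ℝ} (hη : 0 < η) :
    |((n : ℝ)⁻¹) ^ 2 * ∑ t, Var[h1 (fun _ => empirical x) a h t; empirical x]
        - ((n : ℝ)⁻¹) ^ 2 * ∑ t, Var[h1 Q a h t; empirical x]|
      ≤ (1 + η⁻¹) * projGap Q a h x
        + η * (((n : ℝ)⁻¹) ^ 2 * ∑ t, Var[h1 Q a h t; empirical x]) := by
  have := isProbabilityMeasure_empirical hn x
  have key : ∀ t, |Var[h1 (fun _ => empirical x) a h t; empirical x]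
        - Var[h1 Q a h t; empirical x]|
      ≤ (1 + η⁻¹) * ((n : ℝ)⁻¹ * ∑ τ, projDiff Q a h x t (x τ) ^ 2)
        + η * Var[h1 Q a h t; empirical x] := by
    intro t
    have m1 := measurable_h1 (fun _ : Fin n => empirical x) a hh t
    have m2 := measurable_h1 Q a hh t
    set u := h1 (fun _ : Fin n => empirical x) a h t with hu
    set v := h1 Q a h t with hv
    have Lu := memLp_two_empirical hn x m1
    have Lv := memLp_two_empirical hn x m2
    have LD := Lu.sub Lv
    -- The centring terms `theta` do not depend on `y`, so they form a constant invisible to the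
    -- variance.
    have hdiff : ∃ k : ℝ, ∀ y, u y - v y = projDiff Q a h x t y - k := by
      refine ⟨((n - (d + 1))! : ℝ) / ((n - 1)! : ℝ) * ∑ i ∈ distinctTuples n (d + 1), ∑ l,
        if i l = t then a i * (theta (fun _ : Fin n => empirical x) h i - theta Q h i) else 0,
        fun y => ?_⟩
      rw [hu, hv, h1_eq_sum, h1_eq_sum, projDiff, ← mul_sub, ← mul_sub, ← Finset.sum_sub_distrib,
        ← Finset.sum_sub_distrib]
      congr 1
      refine Finset.sum_congr rfl fun i _ => ?_
      rw [← Finset.sum_sub_distrib, ← Finset.sum_sub_distrib]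
      refine Finset.sum_congr rfl fun l _ => ?_
      split_ifs <;> ring
    obtain ⟨k, hk⟩ := hdiff
    have mD : Measurable (projDiff Q a h x t) := by
      have : projDiff Q a h x t = fun y => u y - v y + k := by
        ext y
        linarith [hk y]
      rw [this]
      exact (m1.sub m2).add_const k
    have hVD : Var[u - v; empirical x] ≤ (n : ℝ)⁻¹ * ∑ τ, projDiff Q a h x t (x τ) ^ 2 := by
      have e : u - v = fun y => projDiff Q a h x t y - k := funext hk
      rw [e, variance_sub_const mD.aestronglyMeasurable, variance_empirical hn x mD]
      nlinarith [sq_nonneg ((n : ℝ)⁻¹ * ∑ j, projDiff Q a h x t (x j))]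
    have hVu : Var[u; empirical x] = Var[v; empirical x] + 2 * cov[v, u - v; empirical x]
        + Var[u - v; empirical x] := by
      rw [← variance_add Lv LD]
      congr 1
      ext y
      simp
    -- Nonnegativity of Var(ηv ± (u - v)) gives |2 cov(v, u - v)| ≤ η Var v + η⁻¹ Var(u - v).
    have hp : 0 ≤ η ^ 2 * Var[v; empirical x] + 2 * (η * cov[v, u - v; empirical x])
        + Var[u - v; empirical x] := by
      rw [← covariance_smul_left, ← variance_smul, ← variance_add (Lv.const_smul η) LD]
      exact variance_nonneg _ _
    have hm : 0 ≤ η ^ 2 * Var[v; empirical x] - 2 * (η * cov[v, u - v; empirical x])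
        + Var[u - v; empirical x] := by
      rw [← covariance_smul_left, ← variance_smul, ← variance_sub (Lv.const_smul η) LD]
      exact variance_nonneg _ _
    have hD0 := variance_nonneg (u - v) (empirical x)
    have hcov : |2 * cov[v, u - v; empirical x]|
        ≤ η * Var[v; empirical x] + η⁻¹ * Var[u - v; empirical x] := by
      have e1 : η * (η * Var[v; empirical x] + η⁻¹ * Var[u - v; empirical x])
          = η ^ 2 * Var[v; empirical x] + Var[u - v; empirical x] := by
        field_simp
      rw [abs_le]
      constructor
      · refine le_of_mul_le_mul_left ?_ hη
        linarith
      · refine le_of_mul_le_mul_left ?_ hη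
        linarith
    have hfin : (1 + η⁻¹) * Var[u - v; empirical x]
        ≤ (1 + η⁻¹) * ((n : ℝ)⁻¹ * ∑ τ, projDiff Q a h x t (x τ) ^ 2) :=
      mul_le_mul_of_nonneg_left hVD (by positivity)
    rw [hVu]
    rw [abs_le] at hcov ⊢
    constructor <;> nlinarith
  rw [← mul_sub, ← Finset.sum_sub_distrib, abs_mul, abs_of_nonneg (sq_nonneg _), projGap]
  have hs := (Finset.abs_sum_le_sum_abs (fun t => Var[h1 (fun _ => empirical x) a h t; empirical x]
        - Var[h1 Q a h t; empirical x]) Finset.univ).trans (Finset.sum_le_sum fun t _ => key t)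
  rw [Finset.sum_add_distrib] at hs
  simp only [← Finset.mul_sum] at hs ⊢
  refine (mul_le_mul_of_nonneg_left hs (sq_nonneg _)).trans (le_of_eq ?_)
  ring

end ProjectionGap

/-! ### The expected projection gap -/

section ExpectedGap

variable {Ω 𝒳 : Type*} [MeasurableSpace Ω] [MeasurableSpace 𝒳] {n d : ℕ}
  {P : Measure Ω} {X : Fin n → Ω → 𝒳} {h : (Fin (d + 1) → 𝒳) → ℝ}

/-- Under the empirical law the integrated arguments run over all `r`, repetitions included; the
true projection is constant in `r` and can be moved inside the average. -/
lemma condKernel_empirical_sub_eq (hn : 0 < n) (hh : Measurable h) (l : Fin (d + 1))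
    (s : Fin d → Fin n) (τ : Fin n) (ω : Ω) :
    condKernel (fun _ : Fin n => empirical fun t => X t ω) h l s (X τ ω)
        - condKernel (laws P X) h l s (X τ ω)
      = ((n : ℝ) ^ d)⁻¹ * ∑ r, kernelDev P X h l s τ r ω := by
  have hn' : (n : ℝ) ≠ 0 := by exact_mod_cast hn.ne'
  rw [condKernel_empirical hn _ hh]
  simp only [kernelDev, insertNth_comp (fun t => X t ω), Finset.sum_sub_distrib, mul_sub,
    Finset.sum_const, Finset.card_univ, Fintype.card_fun, Fintype.card_fin, nsmul_eq_mul]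
  congr 1
  push_cast
  rw [inv_mul_cancel_left₀ (pow_ne_zero _ hn')]

/-- `none` carries the shared index `τ`, and the two summands `Fin d` carry the separate averages.
One function `g` then holds all 2d + 1 free indices, so general position is just injectivity of `g`.
-/
lemma average_mul_eq_sum_option (hn : 0 < n) (hh : Measurable h) (l q : Fin (d + 1))
    (s s' : Fin d → Fin n) (ω : Ω) :
    (n : ℝ)⁻¹ * ∑ τ, (condKernel (fun _ : Fin n => empirical fun t => X t ω) h l s (X τ ω)
        - condKernel (laws P X) h l s (X τ ω)) *
      (condKernel (fun _ : Fin n => empirical fun t => X t ω) h q s' (X τ ω)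
        - condKernel (laws P X) h q s' (X τ ω))
      = ((n : ℝ) ^ Fintype.card (Option (Fin d ⊕ Fin d)))⁻¹ *
        ∑ g : Option (Fin d ⊕ Fin d) → Fin n,
          kernelDev P X h l s (g none) (fun k => g (some (Sum.inl k))) ω
            * kernelDev P X h q s' (g none) (fun k => g (some (Sum.inr k))) ω := by
  have e : ∑ g : Option (Fin d ⊕ Fin d) → Fin n,
          kernelDev P X h l s (g none) (fun k => g (some (Sum.inl k))) ω
            * kernelDev P X h q s' (g none) (fun k => g (some (Sum.inr k))) ω
      = ∑ z : Fin n × ((Fin d → Fin n) × (Fin d → Fin n)),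
          kernelDev P X h l s z.1 z.2.1 ω * kernelDev P X h q s' z.1 z.2.2 ω :=
    Fintype.sum_equiv (Equiv.piOptionEquivProd.trans
      (Equiv.prodCongr (Equiv.refl _) (Equiv.sumArrowEquivProdArrow _ _ _))) _ _ fun g => rfl
  simp only [condKernel_empirical_sub_eq hn hh]
  rw [e, Fintype.sum_prod_type]
  simp only [Fintype.sum_prod_type, Fintype.card_option, Fintype.card_sum, Fintype.card_fin]
  rw [Finset.mul_sum, Finset.mul_sum]
  refine Finset.sum_congr rfl fun τ _ => ?_
  rw [← Finset.sum_mul_sum, pow_succ, pow_add, mul_inv, mul_inv]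
  ring

end ExpectedGap

section ExpectedGap

variable {Ω 𝒳 : Type*} [MeasurableSpace Ω] [MeasurableSpace 𝒳] {n d : ℕ}
  {P : Measure Ω} {X : Fin n → Ω → 𝒳} {h : (Fin (d + 1) → 𝒳) → ℝ}

/-- Number of coincidences, relative to `n`, to be excluded for general position. -/
def coincidences (d : ℕ) : ℝ := (2 * d + 1) ^ 2 + (2 * d + 1) * (2 * (d + 1))

lemma coincidences_nonneg (d : ℕ) : 0 ≤ coincidences d := by
  unfold coincidences
  positivity

/-- The forbidden set consists of the entries of `i` and `j`, at most 2(d + 1) values. -/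
lemma abs_average_option_le (hn : 0 < n) (i j : Fin (d + 1) → Fin n)
    (F : (Option (Fin d ⊕ Fin d) → Fin n) → ℝ) {B C : ℝ} (hB : 0 ≤ B) (hC : 0 ≤ C)
    (hall : ∀ g, |F g| ≤ C)
    (hgen : ∀ g, Function.Injective g → (∀ b k, g b ≠ i k) → (∀ b k, g b ≠ j k) → |F g| ≤ B) :
    |((n : ℝ) ^ Fintype.card (Option (Fin d ⊕ Fin d)))⁻¹ * ∑ g, F g|
      ≤ B + C * coincidences d * (n : ℝ)⁻¹ := by
  classical
  set S : Finset (Fin n) := Finset.univ.image i ∪ Finset.univ.image j with hS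
  have hcard : (S.card : ℝ) ≤ 2 * (d + 1) := by
    have h1 : (Finset.univ.image i).card ≤ d + 1 := by
      simpa using Finset.card_image_le (s := (Finset.univ : Finset (Fin (d + 1)))) (f := i)
    have h2 : (Finset.univ.image j).card ≤ d + 1 := by
      simpa using Finset.card_image_le (s := (Finset.univ : Finset (Fin (d + 1)))) (f := j)
    have h3 : S.card ≤ 2 * (d + 1) := (Finset.card_union_le _ _).trans (by omega)
    exact_mod_cast h3
  refine (abs_average_le_of_generic hn S F hB hC hall fun g hg hgS => ?_).trans ?_
  · simp only [hS, Finset.mem_union, Finset.mem_image, Finset.mem_univ, true_and, not_or,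
      not_exists] at hgS
    exact hgen g hg (fun b k hbk => (hgS b).1 k hbk.symm) fun b k hbk => (hgS b).2 k hbk.symm
  · have e : ((Fintype.card (Option (Fin d ⊕ Fin d)) : ℕ) : ℝ) = 2 * d + 1 := by
      simp only [Fintype.card_option, Fintype.card_sum, Fintype.card_fin]
      push_cast
      ring
    rw [e, coincidences]
    gcongr

/-- Tuples with a repetition are a fraction O(1/n) of all, so the von Mises bound `C` enters only
with a factor 1/n. -/
lemma integral_meanSqKernel_le (hn : 0 < n) (hX : ∀ t, Measurable (X t))
    (hh : Measurable h) {B C : ℝ} (hB : 0 ≤ B) (hC : 0 ≤ C)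
    (hdist : ∀ i ∈ distinctTuples n (d + 1),
      ∫⁻ ω, ENNReal.ofReal (h (fun l => X (i l) ω) ^ 2) ∂P ≤ ENNReal.ofReal B)
    (hall : ∀ i : Fin (d + 1) → Fin n,
      ∫⁻ ω, ENNReal.ofReal (h (fun l => X (i l) ω) ^ 2) ∂P ≤ ENNReal.ofReal C) :
    Integrable (fun ω => meanSqKernel h fun t => X t ω) P ∧
    ∫ ω, meanSqKernel h (fun t => X t ω) ∂P ≤ B + C * (d + 1) ^ 2 * (n : ℝ)⁻¹ := by
  have hI : ∀ i : Fin (d + 1) → Fin n, Integrable (fun ω => h (fun k => X (i k) ω) ^ 2) P :=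
    fun i => (memLp_two_of_lintegral_sq_lt_top
      (measurable_kernel_comp hX hh i).aestronglyMeasurable
      ((hall i).trans_lt ENNReal.ofReal_lt_top)).integrable_sq
  have hs := integrable_finsetSum Finset.univ fun i _ => hI i
  refine ⟨hs.const_mul _, ?_⟩
  unfold meanSqKernel
  rw [integral_const_mul, integral_finsetSum _ fun i _ => hI i]
  have hnn : ∀ i : Fin (d + 1) → Fin n, 0 ≤ ∫ ω, h (fun k => X (i k) ω) ^ 2 ∂P :=
    fun i => integral_nonneg fun ω => sq_nonneg _
  have := abs_average_le_of_generic hn ∅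
    (fun i : Fin (d + 1) → Fin n => ∫ ω, h (fun k => X (i k) ω) ^ 2 ∂P) hB hC ?_ ?_
  · refine (le_abs_self _).trans ?_
    simpa using this
  · intro i
    rw [abs_of_nonneg (hnn i)]
    exact integral_sq_le_of_lintegral_sq_le
      (measurable_kernel_comp hX hh i).aestronglyMeasurable hC (hall i)
  · intro i hi _
    rw [abs_of_nonneg (hnn i)]
    exact integral_sq_le_of_lintegral_sq_le
      (measurable_kernel_comp hX hh i).aestronglyMeasurable hB (hdist i (mem_distinctTuples.2 hi))

variable [IsProbabilityMeasure P]

/-- The expected squared distance between the projections under the empirical distribution and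
under the true laws. -/
theorem integral_projGap_le (hn : 0 < n) (hX : ∀ t, Measurable (X t)) (hind : iIndepFun X P)
    (hh : Measurable h) (a : (Fin (d + 1) → Fin n) → ℝ) {B C : ℝ} (hB : 0 ≤ B) (hC : 0 ≤ C)
    (hdist : ∀ i ∈ distinctTuples n (d + 1),
      ∫⁻ ω, ENNReal.ofReal (h (fun l => X (i l) ω) ^ 2) ∂P ≤ ENNReal.ofReal B)
    (hall : ∀ i : Fin (d + 1) → Fin n,
      ∫⁻ ω, ENNReal.ofReal (h (fun l => X (i l) ω) ^ 2) ∂P ≤ ENNReal.ofReal C)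
    (hcopy : ∀ (l : Fin (d + 1)) (j : Fin n), ∀ i ∈ distinctTuples n d,
      ∫⁻ x, ∫⁻ y : Fin d → 𝒳, ENNReal.ofReal (h (l.insertNth x y) ^ 2)
        ∂(Measure.pi fun k => laws P X (i k)) ∂(laws P X j) ≤ ENNReal.ofReal C) :
    Integrable (fun ω => projGap (laws P X) a h fun t => X t ω) P ∧
    ∫ ω, projGap (laws P X) a h (fun t => X t ω) ∂P ≤
      (((n - (d + 1))! : ℝ) / (n ! : ℝ)) ^ 2 *
        ((2 * crossGap P X h + 4 * C * coincidences d * (n : ℝ)⁻¹) * shareSum a 1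
          + (d + 1) ^ 2 * (4 * B + 4 * C * coincidences d * (n : ℝ)⁻¹) * shareSum a 2) := by
  have hQ := fun i => isProbabilityMeasure_laws (P := P) hX i
  have hgap := crossGap_nonneg (P := P) (X := X) h
  have hL : ∀ i : Fin (d + 1) → Fin n, MemLp (fun ω => h (fun k => X (i k) ω)) 2 P := fun i =>
    memLp_two_of_lintegral_sq_lt_top (measurable_kernel_comp hX hh i).aestronglyMeasurable
      ((hall i).trans_lt ENNReal.ofReal_lt_top)
  -- Here `τ` may be an entry of `s`, in which case an independent copy is inserted; this is the
  -- case that `hcopy` covers.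
  have hcond : ∀ l (s : Fin d → Fin n), Function.Injective s → ∀ τ,
      ∫⁻ ω, ENNReal.ofReal (condKernel (laws P X) h l s (X τ ω) ^ 2) ∂P ≤ ENNReal.ofReal C := by
    intro l s hs τ
    refine le_trans (le_of_eq ?_) ((lintegral_sq_condKernel_le (laws P X) hh l s (laws P X τ)).trans
      (hcopy l τ s (mem_distinctTuples.2 hs)))
    rw [laws, lintegral_map _ (hX τ)]
    exact ((measurable_condKernel _ hh l s).pow_const 2).ennreal_ofReal
  have hdev : ∀ l (s : Fin d → Fin n), Function.Injective s → ∀ τ r,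
      MemLp (kernelDev P X h l s τ r) 2 P ∧ ∫ ω, kernelDev P X h l s τ r ω ^ 2 ∂P ≤ 4 * C :=
    fun l s hs τ r => kernelDev_bound hX hh hC (hall _) (hcond l s hs τ)
  -- With distinct indices no copy or repetition occurs, and `B` replaces `C`.
  have hdevB : ∀ l (s : Fin d → Fin n), Function.Injective s → ∀ τ r, Function.Injective r →
      (∀ k, s k ≠ τ) → (∀ k, r k ≠ τ) → ∫ ω, kernelDev P X h l s τ r ω ^ 2 ∂P ≤ 4 * B := by
    intro l s hs τ r hr hsτ hrτ
    refine (kernelDev_bound hX hh hB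
      (hdist _ (mem_distinctTuples.2 (insertNth_injective hr hrτ))) ?_).2
    exact (lintegral_sq_condKernel_le_of_ne hX hind hh l hs hsτ).trans
      (hdist _ (mem_distinctTuples.2 (insertNth_injective hs hsτ)))
  set I := distinctTuples n (d + 1) with hI
  set N : ℝ := ((n : ℝ) ^ Fintype.card (Option (Fin d ⊕ Fin d)))⁻¹ with hN
  set prod : (Fin (d + 1) → Fin n) → Fin (d + 1) → (Fin (d + 1) → Fin n) → Fin (d + 1) →
      (Option (Fin d ⊕ Fin d) → Fin n) → Ω → ℝ := fun i l j q g ω =>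
    kernelDev P X h l (l.removeNth i) (g none) (fun k => g (some (Sum.inl k))) ω
      * kernelDev P X h q (q.removeNth j) (g none) (fun k => g (some (Sum.inr k))) ω with hprod
  have hinj : ∀ i ∈ I, ∀ l : Fin (d + 1), Function.Injective (l.removeNth i) :=
    fun i hi l => removeNth_injective (mem_distinctTuples.1 hi)
  have hprodI : ∀ i ∈ I, ∀ j ∈ I, ∀ l q g, Integrable (prod i l j q g) P :=
    fun i hi j hj l q g =>
      (hdev _ _ (hinj i hi l) _ _).1.integrable_mul (hdev _ _ (hinj j hj q) _ _).1
  have hexp : ∀ ω, projGap (laws P X) a h (fun t => X t ω)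
      = (((n - (d + 1))! : ℝ) / (n ! : ℝ)) ^ 2 * ∑ i ∈ I, ∑ j ∈ I, a i * a j *
        ∑ l, ∑ q, if i l = j q then N * ∑ g, prod i l j q g ω else 0 := by
    intro ω
    rw [projGap_eq hn]
    simp only [average_mul_eq_sum_option hn hh]
    rfl
  have hInt : ∀ i ∈ I, ∀ j ∈ I, ∀ l q : Fin (d + 1), Integrable (fun ω =>
      if i l = j q then N * ∑ g, prod i l j q g ω else 0) P := by
    intro i hi j hj l q
    split_ifs
    · exact (integrable_finsetSum _ fun g _ => hprodI i hi j hj l q g).const_mul N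
    · exact integrable_zero _ _ _
  have hInt2 : ∀ i ∈ I, ∀ j ∈ I, Integrable (fun ω => a i * a j *
        ∑ l, ∑ q, if i l = j q then N * ∑ g, prod i l j q g ω else 0) P := fun i hi j hj =>
    (integrable_finsetSum _ fun l _ => integrable_finsetSum _ fun q _ =>
      hInt i hi j hj l q).const_mul _
  have hEq : ∫ ω, projGap (laws P X) a h (fun t => X t ω) ∂P
      = (((n - (d + 1))! : ℝ) / (n ! : ℝ)) ^ 2 * ∑ i ∈ I, ∑ j ∈ I, a i * a j *
        ∑ l, ∑ q, if i l = j q then N * ∑ g, ∫ ω, prod i l j q g ω ∂P else 0 := by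
    simp only [hexp]
    rw [integral_const_mul, integral_finsetSum _ fun i hi =>
      integrable_finsetSum _ fun j hj => hInt2 i hi j hj]
    congr 1
    refine Finset.sum_congr rfl fun i hi => ?_
    rw [integral_finsetSum _ fun j hj => hInt2 i hi j hj]
    refine Finset.sum_congr rfl fun j hj => ?_
    rw [integral_const_mul, integral_finsetSum _ fun l _ =>
      integrable_finsetSum _ fun q _ => hInt i hi j hj l q]
    congr 1
    refine Finset.sum_congr rfl fun l _ => ?_
    rw [integral_finsetSum _ fun q _ => hInt i hi j hj l q]
    refine Finset.sum_congr rfl fun q _ => ?_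
    split_ifs
    · rw [integral_const_mul, integral_finsetSum _ fun g _ => hprodI i hi j hj l q g]
    · simp
  have hκ := coincidences_nonneg d
  have hprodC : ∀ i ∈ I, ∀ j ∈ I, ∀ l q g, |∫ ω, prod i l j q g ω ∂P| ≤ 4 * C :=
    fun i hi j hj l q g => by
      have h1 := hdev l _ (hinj i hi l) (g none) (fun k => g (some (Sum.inl k)))
      have h2 := hdev q _ (hinj j hj q) (g none) (fun k => g (some (Sum.inr k)))
      exact abs_integral_mul_le_of_integral_sq_le h1.1 h2.1 h1.2 h2.2
  have hrinj : ∀ g : Option (Fin d ⊕ Fin d) → Fin n, Function.Injective g →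
      Function.Injective (fun k => g (some (Sum.inl k))) ∧
      Function.Injective (fun k => g (some (Sum.inr k))) := by
    intro g hg
    exact ⟨fun _ _ hab => Sum.inl_injective (Option.some_injective _ (hg hab)),
      fun _ _ hab => Sum.inr_injective (Option.some_injective _ (hg hab))⟩
  have hrnone : ∀ g : Option (Fin d ⊕ Fin d) → Fin n, Function.Injective g →
      ∀ b, g (some b) ≠ g none := fun g hg b hab => Option.some_ne_none b (hg hab)
  have havgB : ∀ i ∈ I, ∀ j ∈ I, ∀ l q, |N * ∑ g, ∫ ω, prod i l j q g ω ∂P|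
      ≤ 4 * B + 4 * C * coincidences d * (n : ℝ)⁻¹ := by
    intro i hi j hj l q
    refine abs_average_option_le hn i j _ (by positivity) (by positivity)
      (hprodC i hi j hj l q) fun g hg hgi hgj => ?_
    have h1 := hdev l _ (hinj i hi l) (g none) (fun k => g (some (Sum.inl k)))
    have h2 := hdev q _ (hinj j hj q) (g none) (fun k => g (some (Sum.inr k)))
    exact abs_integral_mul_le_of_integral_sq_le h1.1 h2.1
      (hdevB l _ (hinj i hi l) _ _ (hrinj g hg).1 (fun k => (hgi _ _).symm)
        (fun k => hrnone g hg _))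
      (hdevB q _ (hinj j hj q) _ _ (hrinj g hg).2 (fun k => (hgj _ _).symm)
        (fun k => hrnone g hg _))
  refine ⟨?_, ?_⟩
  · simp only [hexp]
    exact (integrable_finsetSum _ fun i hi => integrable_finsetSum _ fun j hj =>
      hInt2 i hi j hj).const_mul _
  rw [hEq]
  refine mul_le_mul_of_nonneg_left ((le_abs_self _).trans ?_) (sq_nonneg _)
  refine abs_sum_sum_mul_le a (fun i j =>
    ∑ l, ∑ q, if i l = j q then N * ∑ g, ∫ ω, prod i l j q g ω ∂P else 0) (by positivity)
    (by positivity) ?_ ?_ ?_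
  · intro i _ j _ hne
    refine Finset.sum_eq_zero fun l _ => Finset.sum_eq_zero fun q _ => ?_
    simp [hne l q]
  · intro i hi j hj p q hpq huniq
    have e : (∑ l, ∑ q, if i l = j q then N * ∑ g, ∫ ω, prod i l j q g ω ∂P else 0)
        = N * ∑ g, ∫ ω, prod i p j q g ω ∂P := by
      rw [Finset.sum_eq_single p, Finset.sum_eq_single q]
      · simp [hpq]
      · exact fun q' _ hne => if_neg fun heq => hne (huniq _ _ heq).2
      · simp
      · exact fun p' _ hne => Finset.sum_eq_zero fun q' _ =>
          if_neg fun heq => hne (huniq _ _ heq).1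
      · simp
    rw [e]
    refine abs_average_option_le hn i j _ (by positivity) (by positivity)
      (hprodC i hi j hj p q) fun g hg hgi hgj => ?_
    -- Once the unique common index is removed, the two tuples are disjoint; all other separations
    -- hold because `g` is injective and avoids `i` and `j`.
    refine abs_integral_kernelDev_mul_le_crossGap hX hind hh hL p q (hinj i hi p) (hinj j hj q)
      (hrinj g hg).1 (hrinj g hg).2 (fun k => (hgi _ _).symm) (fun k => (hgj _ _).symm)
      (fun k => hrnone g hg _) (fun k => hrnone g hg _) ?_ ?_ ?_ ?_
    · exact fun k k' hab => Sum.inl_ne_inr (Option.some_injective _ (hg hab))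
    · exact fun k k' hab => Fin.succAbove_ne p k (huniq _ _ hab).1
    · exact fun k k' => (hgi _ _).symm
    · exact fun k k' => hgj _ _
  · intro i hi j hj
    refine (Finset.abs_sum_le_sum_abs _ _).trans ?_
    refine (Finset.sum_le_card_nsmul _ _
      ((d + 1) * (4 * B + 4 * C * coincidences d * (n : ℝ)⁻¹)) fun l _ => ?_).trans (le_of_eq ?_)
    · refine (Finset.abs_sum_le_sum_abs _ _).trans ?_
      refine (Finset.sum_le_card_nsmul _ _ (4 * B + 4 * C * coincidences d * (n : ℝ)⁻¹)
        fun q _ => ?_).trans (le_of_eq ?_)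
      · split_ifs
        · exact havgB i hi j hj l q
        · rw [abs_zero]
          positivity
      · simp only [Finset.card_univ, Fintype.card_fin, nsmul_eq_mul]
        push_cast
        rfl
    · simp only [Finset.card_univ, Fintype.card_fin, nsmul_eq_mul]
      push_cast
      ring

end ExpectedGap

/-! ### Convergence in probability -/

section InProbability

variable {Ω : ℕ → Type*} [∀ n, MeasurableSpace (Ω n)] {P : ∀ n, Measure (Ω n)}

lemma exists_eventually_le_of_limsup_lt_top {f : ℕ → ℝ≥0∞} (hf : limsup f atTop < ⊤) :
    ∃ C : ℝ, 0 ≤ C ∧ ∀ᶠ n in atTop, f n ≤ ENNReal.ofReal C := by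
  obtain ⟨C, hC, -⟩ := ENNReal.lt_iff_exists_nnreal_btwn.1 hf
  refine ⟨C, C.2, (eventually_lt_of_limsup_lt hC).mono fun n hn => ?_⟩
  rw [ENNReal.ofReal_coe_nnreal]
  exact hn.le

lemma tendstoInProb_zero_of_integral_le [∀ n, IsProbabilityMeasure (P n)] {Z : ∀ n, Ω n → ℝ}
    {b : ℕ → ℝ} (hZ : ∀ n ω, 0 ≤ Z n ω)
    (hb : ∀ᶠ n in atTop, Integrable (Z n) (P n) ∧ ∫ ω, Z n ω ∂P n ≤ b n)
    (hlim : Tendsto b atTop (𝓝 0)) : TendstoInProb P Z 0 := by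
  intro ε hε
  have hlim' : Tendsto (fun n => ENNReal.ofReal (ε⁻¹ * b n)) atTop (𝓝 0) := by
    have := ENNReal.tendsto_ofReal (hlim.const_mul ε⁻¹)
    simpa using this
  refine tendsto_of_tendsto_of_tendsto_of_le_of_le' tendsto_const_nhds hlim'
    (Eventually.of_forall fun n => zero_le) ?_
  filter_upwards [hb] with n hn
  have h1 := mul_meas_ge_le_integral_of_nonneg (ae_of_all (P n) (hZ n)) hn.1 ε
  have h2 : {ω | ε ≤ |Z n ω - 0|} = {ω | ε ≤ Z n ω} := by
    ext ω
    simp [abs_of_nonneg (hZ n ω)]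
  rw [h2, ← ofReal_measureReal]
  refine ENNReal.ofReal_le_ofReal ?_
  rw [le_inv_mul_iff₀ hε]
  exact h1.trans hn.2

/-- A quantity controlled by three others that converge in probability converges too. -/
lemma tendstoInProb_of_control {Z Z₁ Z₂ Z₃ : ∀ n, Ω n → ℝ} {c c₁ c₂ c₃ : ℝ}
    (h₁ : TendstoInProb P Z₁ c₁) (h₂ : TendstoInProb P Z₂ c₂) (h₃ : TendstoInProb P Z₃ c₃)
    (hctrl : ∀ ε > 0, ∃ δ > 0, ∀ᶠ n in atTop, ∀ ω, |Z₁ n ω - c₁| < δ → |Z₂ n ω - c₂| < δ →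
      |Z₃ n ω - c₃| < δ → |Z n ω - c| < ε) : TendstoInProb P Z c := by
  intro ε hε
  obtain ⟨δ, hδ, hn⟩ := hctrl ε hε
  have hlim := ((h₁ δ hδ).add (h₂ δ hδ)).add (h₃ δ hδ)
  simp only [add_zero] at hlim
  refine tendsto_of_tendsto_of_tendsto_of_le_of_le' tendsto_const_nhds hlim
    (Eventually.of_forall fun n => zero_le) ?_
  filter_upwards [hn] with n hn
  refine le_trans (measure_mono ?_) ((measure_union_le _ _).trans
    (add_le_add (measure_union_le _ _) le_rfl))
  intro ω hω
  simp only [Set.mem_union, Set.mem_ofPred_eq] at hω ⊢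
  by_contra! hcon
  exact absurd (hn ω hcon.1.1 hcon.1.2 hcon.2) (not_lt.2 hω)

end InProbability

/-! ### Rates and the heterogeneity sums -/

section Rates

lemma sigma_sq {Ω 𝒳 : Type*} [MeasurableSpace Ω] {n m : ℕ} (P : Measure Ω) (X : Fin n → Ω → 𝒳)
    (a : (Fin m → Fin n) → ℝ) (h : (Fin m → 𝒳) → ℝ) :
    sigma P X a h ^ 2 = Var[fun ω => uStat a h (fun i => X i ω); P] :=
  Real.sq_sqrt (variance_nonneg _ _)

variable {𝒳 : Type*} [MeasurableSpace 𝒳] {n d : ℕ} {h : (Fin (d + 1) → 𝒳) → ℝ}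

lemma factorial_ratio_sq_mul_shareSum_one_le (a : (Fin (d + 1) → Fin n) → ℝ)
    (hn : 2 * (d + 1) ≤ n) :
    (((n - (d + 1))! : ℝ) / (n ! : ℝ)) ^ 2 * shareSum a 1
      ≤ 4 ^ (d + 1) * (d + 1) ^ 2 * ((n : ℝ)⁻¹ * avgWeight a 2 1) := by
  have := factorial_ratio_sq_mul_shareSum_le a (q := 1) (k := (d + 1) ^ 2) (by omega) hn
    (by simpa using card_sharing_one_mul_le (n := n) (m := d + 1))
  simpa using this

lemma factorial_ratio_sq_mul_shareSum_two_le (a : (Fin (d + 1) → Fin n) → ℝ)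
    (hn : 2 * (d + 1) ≤ n) :
    (((n - (d + 1))! : ℝ) / (n ! : ℝ)) ^ 2 * shareSum a 2
      ≤ 4 ^ (d + 1) * (d + 1) ^ 4 * (((n : ℝ) ^ 2)⁻¹ * avgWeight a 2 2) := by
  have := factorial_ratio_sq_mul_shareSum_le a (q := 2) (k := (d + 1) ^ 4) (by omega) hn
    (card_sharing_two_mul_le (n := n) (m := d + 1))
  simpa using this

/-- The difference of the two heterogeneity sums is the empirical variance of the expansion. -/
lemma sum_sq_sub_sq_sum_eq (hn : 0 < n) (Q : Fin n → Measure 𝒳) [∀ i, IsProbabilityMeasure (Q i)]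
    (a : (Fin (d + 1) → Fin n) → ℝ) (hh : Measurable h) (x : Fin n → 𝒳) (s : ℝ) :
    (1 / (n : ℝ)) * ∑ i, ∑ j, (h1 Q a h i (x j) / (n * s)) ^ 2
        - (1 / (n : ℝ) ^ 2) * ∑ i, (∑ j, h1 Q a h i (x j) / (n * s)) ^ 2
      = (s ^ 2)⁻¹ * (((n : ℝ)⁻¹) ^ 2 * ∑ t, Var[h1 Q a h t; empirical x]) := by
  rw [Finset.mul_sum, Finset.mul_sum, ← Finset.sum_sub_distrib, Finset.mul_sum, Finset.mul_sum]
  refine Finset.sum_congr rfl fun t _ => ?_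
  rw [variance_empirical hn x (measurable_h1 Q a hh t)]
  simp only [div_eq_mul_inv, mul_inv, inv_pow, one_mul, mul_pow,
    ← Finset.sum_mul]
  ring

end Rates

end WeightedU

end

/-! ### Consistency of the bootstrap variance -/

theorem mainTheorem3
    {𝒳 : Type*} [MeasurableSpace 𝒳]
    -- a triangular array of row-wise independent random variables
    {Ω : ℕ → Type*} [∀ n, MeasurableSpace (Ω n)]
    (P : ∀ n, Measure (Ω n)) [∀ n, IsProbabilityMeasure (P n)]
    (X : ∀ n, Fin n → Ω n → 𝒳) (hX : ∀ n i, Measurable (X n i))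
    (hindep : ∀ n, iIndepFun (X n) (P n))
    -- weights and kernels of degree `m = d + 1`
    (d : ℕ) (a : ∀ n, (Fin (d + 1) → Fin n) → ℝ)
    (h : ℕ → (Fin (d + 1) → 𝒳) → ℝ) (hh : ∀ n, Measurable (h n))
    -- the conditions of the central limit theorem
    (M : ℕ → ℝ) (hM : ∀ n, 0 < M n)
    (hmoment : ∀ n, ∀ i ∈ distinctTuples n (d + 1),
      ∫⁻ ω, ENNReal.ofReal (h n (fun l => X n (i l) ω) ^ 4) ∂P n ≤ ENNReal.ofReal (M n))
    (hV : ∀ᶠ n in atTop, 0 < mainVar (P n) (X n) (a n) (h n))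
    (hclt₁ : Tendsto (fun n : ℕ => (n : ℝ) ^ (-2 : ℝ) * mainVar (P n) (X n) (a n) (h n) ^ (-1 : ℝ)
      * avgWeight (a n) 2 2 * M n ^ (1 / 2 : ℝ)) atTop (𝓝 0))
    (hclt₂ : Tendsto (fun n : ℕ => (n : ℝ) ^ (-2 : ℝ)
      * mainVar (P n) (X n) (a n) (h n) ^ (-(3 / 2) : ℝ)
      * avgWeight (a n) 3 1 * M n ^ (3 / 4 : ℝ)) atTop (𝓝 0))
    -- (i) bounded second moments, repeated indices standing for the same random variable ...
    (hvonMises : limsup (fun n => ⨆ i : Fin (d + 1) → Fin n,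
      ∫⁻ ω, ENNReal.ofReal (h n (fun l => X n (i l) ω) ^ 2) ∂P n) atTop < ⊤)
    -- ... and when an independent copy of some `X_j` is inserted among distinct `X_{i_k}`
    (hcopy : limsup (fun n => ⨆ (l : Fin (d + 1)) (j : Fin n) (i ∈ distinctTuples n d),
      ∫⁻ x, ∫⁻ y : Fin d → 𝒳, ENNReal.ofReal (h n (l.insertNth x y) ^ 2)
        ∂(Measure.pi fun k => laws (P n) (X n) (i k)) ∂(laws (P n) (X n) j)) atTop < ⊤)
    -- (ii) control of heterogeneity
    (hhomo₁ : TendstoInProb P (fun n ω => (1 / (n : ℝ)) * ∑ i, ∑ j,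
      (h1 (laws (P n) (X n)) (a n) (h n) i (X n j ω)
        / (n * sigma (P n) (X n) (a n) (h n))) ^ 2) 1)
    (hhomo₂ : TendstoInProb P (fun n ω => (1 / (n : ℝ) ^ 2) * ∑ i, (∑ j,
      h1 (laws (P n) (X n)) (a n) (h n) i (X n j ω)
        / (n * sigma (P n) (X n) (a n) (h n))) ^ 2) 0)
    (hhet : Tendsto (fun n : ℕ => (n : ℝ)⁻¹ * (sigma (P n) (X n) (a n) (h n) ^ 2)⁻¹
      * avgWeight (a n) 2 1
      * (meanGap (P n) (X n) (h n) ^ 2 + crossGap (P n) (X n) (h n) + (n : ℝ)⁻¹)) atTop (𝓝 0)) :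
    TendstoInProb P (fun n ω =>
      |Var[fun x => (sigma (P n) (X n) (a n) (h n))⁻¹ * uStat (a n) (h n) x;
          bootstrapLaw fun i => X n i ω]
        - Var[fun ω' => (sigma (P n) (X n) (a n) (h n))⁻¹
          * uStat (a n) (h n) (fun i => X n i ω'); P n]|) 0 := by
  obtain ⟨C₁, hC₁, hvM⟩ := exists_eventually_le_of_limsup_lt_top hvonMises
  obtain ⟨C₂, hC₂, hcp⟩ := exists_eventually_le_of_limsup_lt_top hcopy
  set C := max C₁ C₂ with hCdef
  have hC : 0 ≤ C := hC₁.trans (le_max_left _ _)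
  have hall : ∀ᶠ n in atTop, ∀ i : Fin (d + 1) → Fin n,
      ∫⁻ ω, ENNReal.ofReal (h n (fun l => X n (i l) ω) ^ 2) ∂P n ≤ ENNReal.ofReal C := by
    filter_upwards [hvM] with n hn i
    exact (le_iSup (fun i : Fin (d + 1) → Fin n =>
      ∫⁻ ω, ENNReal.ofReal (h n (fun l => X n (i l) ω) ^ 2) ∂P n) i).trans
      (hn.trans (ENNReal.ofReal_le_ofReal (le_max_left _ _)))
  have hcopy' : ∀ᶠ n in atTop, ∀ (l : Fin (d + 1)) (j : Fin n), ∀ i ∈ distinctTuples n d,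
      ∫⁻ x, ∫⁻ y : Fin d → 𝒳, ENNReal.ofReal (h n (l.insertNth x y) ^ 2)
        ∂(Measure.pi fun k => laws (P n) (X n) (i k)) ∂(laws (P n) (X n) j)
        ≤ ENNReal.ofReal C := by
    filter_upwards [hcp] with n hn l j i hi
    refine le_trans ?_ (hn.trans (ENNReal.ofReal_le_ofReal (le_max_right _ _)))
    exact le_iSup_of_le l (le_iSup_of_le j (le_iSup₂_of_le i hi le_rfl))
  have hdist : ∀ n, ∀ i ∈ distinctTuples n (d + 1),
      ∫⁻ ω, ENNReal.ofReal (h n (fun l => X n (i l) ω) ^ 2) ∂P n ≤ ENNReal.ofReal (√(M n)) :=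
    fun n i hi => lintegral_sq_le_of_lintegral_pow_four_le
      (measurable_kernel_comp (hX n) (hh n) i).aestronglyMeasurable (hM n).le (hmoment n i hi)
  have hQ : ∀ n i, IsProbabilityMeasure (laws (P n) (X n) i) :=
    fun n i => isProbabilityMeasure_laws (hX n) i
  -- abbreviations for the rates
  set V : ℕ → ℝ := fun n => mainVar (P n) (X n) (a n) (h n) with hVdef
  set s : ℕ → ℝ := fun n => sigma (P n) (X n) (a n) (h n) ^ 2 with hs
  set c : ℕ → ℝ := fun n => (((n - (d + 1))! : ℝ) / (n ! : ℝ)) ^ 2 with hc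
  have hc0 : ∀ n, 0 ≤ c n := fun n => sq_nonneg _
  have hs0 : ∀ n, 0 ≤ s n := fun n => sq_nonneg _
  set k : ℝ := 4 ^ (d + 1) * (d + 1) ^ 4 with hk
  have hk0 : 0 < k := by positivity
  have hβ : Tendsto (fun n : ℕ => ((n : ℝ) ^ 2)⁻¹ * (V n)⁻¹ * avgWeight (a n) 2 2 * √(M n)) atTop
      (𝓝 0) := by
    refine hclt₁.congr fun n => ?_
    rw [Real.rpow_neg_one, Real.rpow_neg (Nat.cast_nonneg n), Real.rpow_ofNat, Real.sqrt_eq_rpow]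
  have hlarge : ∀ᶠ n : ℕ in atTop, 2 * (d + 1) ≤ n := eventually_ge_atTop _
  -- The variance comparison under the true law has error o(V), eventually at most V/2; so rates
  -- relative to V hold relative to σ² up to a factor 2.
  have hsV : ∀ᶠ n in atTop, 0 < V n ∧ V n / 2 ≤ s n := by
    have hsmall : ∀ᶠ n : ℕ in atTop, (1 + ((d : ℝ) + 1) ^ 2) * k *
        (((n : ℝ) ^ 2)⁻¹ * (V n)⁻¹ * avgWeight (a n) 2 2 * √(M n)) < 1 / 2 := by
      have := hβ.const_mul ((1 + ((d : ℝ) + 1) ^ 2) * k)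
      rw [mul_zero] at this
      exact this.eventually (gt_mem_nhds (by norm_num))
    filter_upwards [hV, hsmall, hlarge] with n hVn hsm hn
    refine ⟨hVn, ?_⟩
    have h1 := abs_variance_uStat_sub_mainVar_le (hX n) (hindep n) (hh n) (a n)
      (Real.sqrt_nonneg (M n)) (hdist n) (by omega)
    rw [← sigma_sq] at h1
    have h2 := factorial_ratio_sq_mul_shareSum_two_le (a n) hn
    have h3 : c n * ((1 + ((d : ℝ) + 1) ^ 2) * √(M n) * shareSum (a n) 2) ≤ 1 / 2 * V n := by
      calc c n * ((1 + ((d : ℝ) + 1) ^ 2) * √(M n) * shareSum (a n) 2)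
          = (1 + ((d : ℝ) + 1) ^ 2) * √(M n) * (c n * shareSum (a n) 2) := by ring
        _ ≤ (1 + ((d : ℝ) + 1) ^ 2) * √(M n) *
            (k * (((n : ℝ) ^ 2)⁻¹ * avgWeight (a n) 2 2)) :=
          mul_le_mul_of_nonneg_left h2 (by positivity)
        _ = (1 + ((d : ℝ) + 1) ^ 2) * k *
            (((n : ℝ) ^ 2)⁻¹ * (V n)⁻¹ * avgWeight (a n) 2 2 * √(M n)) * V n := by
          have : V n ≠ 0 := hVn.ne'
          field_simp
        _ ≤ 1 / 2 * V n := mul_le_mul_of_nonneg_right hsm.le hVn.le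
    have h4 := (abs_le.1 (h1.trans h3)).1
    change -(1 / 2 * V n) ≤ s n - V n at h4
    linarith
  -- the two vanishing rates
  set x₁ : ℕ → ℝ := fun n => (s n)⁻¹ * (c n * shareSum (a n) 1)
    * (crossGap (P n) (X n) (h n) + (n : ℝ)⁻¹) with hx₁
  set x₂ : ℕ → ℝ := fun n => (s n)⁻¹ * (c n * shareSum (a n) 2) * √(M n) with hx₂
  have hx₁0 : ∀ n, 0 ≤ x₁ n := fun n => by
    have := shareSum_nonneg (a n) 1
    have := crossGap_nonneg (P := P n) (X := X n) (h n)
    have := hs0 n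
    have := hc0 n
    positivity
  have hx₂0 : ∀ n, 0 ≤ x₂ n := fun n => by
    have := shareSum_nonneg (a n) 2
    have := hs0 n
    have := hc0 n
    positivity
  have hx₁lim : Tendsto x₁ atTop (𝓝 0) := by
    have hlim := hhet.const_mul (4 ^ (d + 1) * ((d : ℝ) + 1) ^ 2)
    rw [mul_zero] at hlim
    refine tendsto_of_tendsto_of_tendsto_of_le_of_le' tendsto_const_nhds hlim
      (Eventually.of_forall hx₁0) ?_
    filter_upwards [hlarge] with n hn
    have hA := avgWeight_nonneg (a n) 2 1
    have hg := crossGap_nonneg (P := P n) (X := X n) (h n)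
    have hsn := hs0 n
    calc x₁ n ≤ (s n)⁻¹ * (4 ^ (d + 1) * ((d : ℝ) + 1) ^ 2 * ((n : ℝ)⁻¹ * avgWeight (a n) 2 1))
          * (crossGap (P n) (X n) (h n) + (n : ℝ)⁻¹) := by
          refine mul_le_mul_of_nonneg_right (mul_le_mul_of_nonneg_left ?_ (by positivity))
            (by positivity)
          exact factorial_ratio_sq_mul_shareSum_one_le (a n) hn
      _ = 4 ^ (d + 1) * ((d : ℝ) + 1) ^ 2 * ((n : ℝ)⁻¹ * (s n)⁻¹ * avgWeight (a n) 2 1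
          * (crossGap (P n) (X n) (h n) + (n : ℝ)⁻¹)) := by ring
      _ ≤ _ := by
          refine mul_le_mul_of_nonneg_left (mul_le_mul_of_nonneg_left ?_ (by positivity))
            (by positivity)
          nlinarith [sq_nonneg (meanGap (P n) (X n) (h n))]
  have hx₂lim : Tendsto x₂ atTop (𝓝 0) := by
    have hlim := hβ.const_mul (2 * k)
    rw [mul_zero] at hlim
    refine tendsto_of_tendsto_of_tendsto_of_le_of_le' tendsto_const_nhds hlim
      (Eventually.of_forall hx₂0) ?_
    filter_upwards [hlarge, hsV] with n hn hsVn
    have hA := avgWeight_nonneg (a n) 2 2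
    have hinv : (s n)⁻¹ ≤ 2 * (V n)⁻¹ := by
      rw [← div_eq_mul_inv, ← inv_div]
      exact inv_anti₀ (by linarith [hsVn.1]) hsVn.2
    have hS := shareSum_nonneg (a n) 2
    calc x₂ n ≤ (2 * (V n)⁻¹) * (k * (((n : ℝ) ^ 2)⁻¹ * avgWeight (a n) 2 2)) * √(M n) := by
          refine mul_le_mul_of_nonneg_right (mul_le_mul hinv ?_ (mul_nonneg (hc0 n) hS) ?_)
            (Real.sqrt_nonneg _)
          · exact factorial_ratio_sq_mul_shareSum_two_le (a n) hn
          · have := hsVn.1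
            positivity
      _ = _ := by ring
  -- Pairs with two common indices also have one, so their C/n terms are absorbed by `x₁`, and no
  -- comparison of `C` with `√(M n)` is needed.
  have hx₂₁ : ∀ n : ℕ, (s n)⁻¹ * (c n * shareSum (a n) 2) * (n : ℝ)⁻¹ ≤ x₁ n := by
    intro n
    have hg := crossGap_nonneg (P := P n) (X := X n) (h n)
    have hsn := hs0 n
    have hcn := hc0 n
    have hS := shareSum_nonneg (a n) 1
    refine mul_le_mul (mul_le_mul_of_nonneg_left (mul_le_mul_of_nonneg_left
      (shareSum_two_le_one (a n)) hcn) (by positivity)) (by linarith) (by positivity)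
      (by positivity)
  have hx₁' : ∀ n : ℕ, (s n)⁻¹ * (c n * shareSum (a n) 1) * crossGap (P n) (X n) (h n) ≤ x₁ n ∧
      (s n)⁻¹ * (c n * shareSum (a n) 1) * (n : ℝ)⁻¹ ≤ x₁ n := by
    intro n
    have hg := crossGap_nonneg (P := P n) (X := X n) (h n)
    have hsn := hs0 n
    have hcn := hc0 n
    have hS := shareSum_nonneg (a n) 1
    have hn0 : 0 ≤ (n : ℝ)⁻¹ := by positivity
    constructor <;> refine mul_le_mul_of_nonneg_left ?_ (by positivity) <;> linarith
  -- the remainder terms vanish in probability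
  have hR : TendstoInProb P (fun n ω => (s n)⁻¹ *
      projGap (laws (P n) (X n)) (a n) (h n) fun t => X n t ω) 0 := by
    refine tendstoInProb_zero_of_integral_le (b := fun n =>
      2 * x₁ n + 4 * C * coincidences d * x₁ n
        + ((d : ℝ) + 1) ^ 2 * (4 * x₂ n + 4 * C * coincidences d * x₁ n))
      (fun n ω => mul_nonneg (inv_nonneg.2 (hs0 n)) (projGap_nonneg _ _ _ _)) ?_ ?_
    · filter_upwards [hall, hcopy', hlarge] with n halln hcopyn hn
      obtain ⟨hI, hle⟩ := integral_projGap_le (by omega) (hX n) (hindep n) (hh n) (a n)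
        (Real.sqrt_nonneg (M n)) hC (hdist n) halln hcopyn
      refine ⟨hI.const_mul _, ?_⟩
      rw [integral_const_mul]
      refine (mul_le_mul_of_nonneg_left hle (inv_nonneg.2 (hs0 n))).trans ?_
      have hκ := coincidences_nonneg d
      have h1 := mul_le_mul_of_nonneg_left (hx₁' n).2
        (show 0 ≤ 4 * C * coincidences d by positivity)
      have h2 := mul_le_mul_of_nonneg_left (hx₂₁ n)
        (show 0 ≤ ((d : ℝ) + 1) ^ 2 * (4 * C * coincidences d) by positivity)
      calc _ = 2 * ((s n)⁻¹ * (c n * shareSum (a n) 1) * crossGap (P n) (X n) (h n))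
            + 4 * C * coincidences d * ((s n)⁻¹ * (c n * shareSum (a n) 1) * (n : ℝ)⁻¹)
            + (((d : ℝ) + 1) ^ 2 * (4 * x₂ n) + ((d : ℝ) + 1) ^ 2 * (4 * C * coincidences d) *
              ((s n)⁻¹ * (c n * shareSum (a n) 2) * (n : ℝ)⁻¹)) := by
            simp only [hx₂, hc]
            ring
        _ ≤ _ := by linarith [(hx₁' n).1]
    · have := ((hx₁lim.const_mul 2).add (hx₁lim.const_mul (4 * C * coincidences d))).add
        (((hx₂lim.const_mul 4).add (hx₁lim.const_mul (4 * C * coincidences d))).const_mul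
          (((d : ℝ) + 1) ^ 2))
      simpa using this
  have hT : TendstoInProb P (fun n ω => (s n)⁻¹ * (c n * ((1 + ((d : ℝ) + 1) ^ 2)
      * meanSqKernel (h n) (fun t => X n t ω) * shareSum (a n) 2))) 0 := by
    refine tendstoInProb_zero_of_integral_le (b := fun n =>
      (1 + ((d : ℝ) + 1) ^ 2) * (x₂ n + C * ((d : ℝ) + 1) ^ 2 * x₁ n)) (fun n ω => ?_) ?_ ?_
    · have := hs0 n
      have := hc0 n
      have := shareSum_nonneg (a n) 2
      have := meanSqKernel_nonneg (h n) fun t => X n t ω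
      positivity
    · filter_upwards [hall, hlarge] with n halln hn
      obtain ⟨hI, hle⟩ := integral_meanSqKernel_le (by omega) (hX n) (hh n)
        (Real.sqrt_nonneg (M n)) hC (hdist n) halln
      refine ⟨(((hI.const_mul _).mul_const _).const_mul _).const_mul _, ?_⟩
      rw [integral_const_mul, integral_const_mul, integral_mul_const, integral_const_mul]
      have hS := shareSum_nonneg (a n) 2
      have hsn := hs0 n
      have hcn := hc0 n
      have h2 := mul_le_mul_of_nonneg_left (hx₂₁ n)
        (show 0 ≤ (1 + ((d : ℝ) + 1) ^ 2) * (C * ((d : ℝ) + 1) ^ 2) by positivity)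
      calc _ = (s n)⁻¹ * (c n * shareSum (a n) 2) * (1 + ((d : ℝ) + 1) ^ 2)
            * ∫ ω, meanSqKernel (h n) (fun t => X n t ω) ∂P n := by ring
        _ ≤ (s n)⁻¹ * (c n * shareSum (a n) 2) * (1 + ((d : ℝ) + 1) ^ 2)
            * (√(M n) + C * ((d : ℝ) + 1) ^ 2 * (n : ℝ)⁻¹) :=
          mul_le_mul_of_nonneg_left hle (by positivity)
        _ = (1 + ((d : ℝ) + 1) ^ 2) * x₂ n + (1 + ((d : ℝ) + 1) ^ 2) * (C * ((d : ℝ) + 1) ^ 2)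
            * ((s n)⁻¹ * (c n * shareSum (a n) 2) * (n : ℝ)⁻¹) := by
            simp only [hx₂]
            ring
        _ ≤ _ := by linarith
    · have := (hx₂lim.add (hx₁lim.const_mul (C * ((d : ℝ) + 1) ^ 2))).const_mul
        (1 + ((d : ℝ) + 1) ^ 2)
      simpa using this
  have hG : TendstoInProb P (fun n ω => (s n)⁻¹ * (((n : ℝ)⁻¹) ^ 2 *
      ∑ t, Var[h1 (laws (P n) (X n)) (a n) (h n) t; empirical fun t => X n t ω])) 1 := by
    -- Two inputs suffice; the second is repeated to fill the third slot.
    refine tendstoInProb_of_control hhomo₁ hhomo₂ hhomo₂ fun ε hε => ⟨ε / 2, by positivity, ?_⟩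
    filter_upwards [hlarge] with n hn ω h₁ h₂ _
    rw [hs, ← sum_sq_sub_sq_sum_eq (by omega) _ _ (hh n)]
    rw [abs_lt] at h₁ h₂ ⊢
    constructor <;> linarith [h₁.1, h₁.2, h₂.1, h₂.2]
  -- conclusion
  refine tendstoInProb_of_control hG hR hT fun ε hε => ?_
  -- The tolerance is split into four parts ε/4: the bootstrap remainder, (1 + η⁻¹) times the scaled
  -- gap, η times the scaled empirical variance, and the distance of the latter from 1. The bound 1
  -- in the minimum below keeps the scaled empirical variance under 2, so η = ε/8 makes the third
  -- part less than ε/4.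
  set η : ℝ := ε / 8 with hη
  have hη0 : 0 < η := by positivity
  refine ⟨min 1 (min (ε / 4) (ε / 4 * (1 + η⁻¹)⁻¹)), by positivity, ?_⟩
  filter_upwards [hlarge, hsV] with n hn hsVn ω h₁ h₂ h₃
  have hspos : 0 < s n := lt_of_lt_of_le (by linarith [hsVn.1]) hsVn.2
  have hn0 : 0 < n := by omega
  have hvar : Var[fun ω' => (sigma (P n) (X n) (a n) (h n))⁻¹
      * uStat (a n) (h n) (fun i => X n i ω'); P n] = 1 := by
    rw [variance_const_mul, ← sigma_sq, inv_pow]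
    exact inv_mul_cancel₀ hspos.ne'
  rw [hvar, variance_const_mul, inv_pow, sub_zero, abs_abs]
  have b₁ := abs_variance_bootstrap_sub_le hn0 (fun t => X n t ω) (a n) (hh n)
  have b₂ := abs_sum_variance_sub_le_projGap hn0 (laws (P n) (X n)) (a n) (hh n)
    (fun t => X n t ω) hη0
  rw [lt_min_iff, lt_min_iff] at h₁ h₂ h₃
  have hspos' : 0 ≤ (s n)⁻¹ := inv_nonneg.2 hspos.le
  set G := ((n : ℝ)⁻¹) ^ 2 *
      ∑ t, Var[h1 (laws (P n) (X n)) (a n) (h n) t; empirical fun t => X n t ω] with hGdef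
  set G' := ((n : ℝ)⁻¹) ^ 2 *
      ∑ t, Var[h1 (fun _ => empirical fun t => X n t ω) (a n) (h n) t;
        empirical fun t => X n t ω] with hGdef'
  set R := projGap (laws (P n) (X n)) (a n) (h n) fun t => X n t ω with hRdef
  set W := Var[uStat (a n) (h n); bootstrapLaw fun i => X n i ω] with hW
  have r₁ := mul_le_mul_of_nonneg_left b₁ hspos'
  have r₂ := mul_le_mul_of_nonneg_left b₂ hspos'
  have hT' := (le_abs_self _).trans_lt h₃.2.1
  have hR' := (le_abs_self _).trans_lt h₂.2.2
  rw [sub_zero] at hT' hR'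
  have hR'' : (1 + η⁻¹) * ((s n)⁻¹ * R) < ε / 4 := by
    rw [mul_comm]
    exact (lt_mul_inv_iff₀ (by positivity)).1 hR'
  have hG1 := abs_lt.1 h₁.2.1
  have hG2 := abs_lt.1 h₁.1
  have hGη : η * ((s n)⁻¹ * G) < ε / 4 := by
    have : η * ((s n)⁻¹ * G) < η * 2 := mul_lt_mul_of_pos_left (by linarith) hη0
    linarith
  have t₁ : |(s n)⁻¹ * W - (s n)⁻¹ * G'| < ε / 4 := by
    rw [← mul_sub, abs_mul, abs_of_nonneg hspos']
    exact r₁.trans_lt hT'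
  have t₂ : |(s n)⁻¹ * G' - (s n)⁻¹ * G| < ε / 4 + ε / 4 := by
    rw [← mul_sub, abs_mul, abs_of_nonneg hspos']
    refine r₂.trans_lt ?_
    calc _ = (1 + η⁻¹) * ((s n)⁻¹ * R) + η * ((s n)⁻¹ * G) := by ring
      _ < _ := add_lt_add hR'' hGη
  change |(s n)⁻¹ * W - 1| < ε
  rw [abs_lt] at t₁ t₂ ⊢
  constructor <;> linarith [t₁.1, t₁.2, t₂.1, t₂.2, hG1.1, hG1.2]
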